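/- Let $F:\mathbb{R}^p\to\mathbb{R}^p$ be single-valued, $T:\mathbb{R}^p\rightrightarrows\mathbb{R}^p$ set-valued, $\Phi:=F+T$ (that is, $\Phi x=\{Fx+\xi:\xi\in Tx\}$) and $\operatorname{zer}\Phi:=\{x: 0\in\Phi x\}$. Suppose that $\operatorname{zer}\Phi\neq\emptyset$; that $F$ is $L$-Lipschitz continuous for some $L>0$; that $\Phi$ is $\rho$-co-hypomonotone for some $\rho\ge 0$, i.e. $\langle u-v,x-y\rangle\ge-\rho\|u-v\|^2$ whenever $u\in\Phi x$, $v\in\Phi y$; and that $T$ is closed, i.e. its graph is closed. Fix $r>2$, $\mu>1$, $\kappa\ge 0$, $\epsilon\ge 0$, $\hat\epsilon\ge 0$ and $0\le\hat\kappa<\frac{3r-1}{3r(12+3r+\hat\epsilon)}$, and put $$\Psi:=\frac{1-\frac{1}{3r}-\hat\kappa(12+3r+\hat\epsilon)}{\sqrt{4+12\kappa+3\kappa r+\kappa\hat\epsilon}},\qquad \bar\eta:=\frac{\Psi}{L},\qquad \beta:=8\rho+2\epsilon .$$ Suppose that $L\rho<\frac{(r-2)\Psi}{8(r+\mu-1)}$,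 and let $\eta$ satisfy $\eta>\beta$ and $\frac{(r+\mu-1)\beta}{r-2}\le\eta<\bar\eta$. Define $$\delta:=(r-1)\beta+\tfrac{(r-2)(\eta-\beta)}{\mu+1},\qquad \omega:=\tfrac{\mu(\eta-\beta)}{\mu+1},$$ $$D:=2\delta+\omega(r+\mu-1)^2+6r\eta+2\beta+2\hat\epsilon\eta,\qquad E:=4\rho r(r-2)+3r\eta+8\rho+\hat\epsilon\eta,\qquad \bar t_0:=\tfrac{D+\sqrt{D^2+4\eta E}}{2\eta},$$ $$A:=\tfrac{(\eta-\beta)^2}{(\mu+1)^2}\big(\mu-\tfrac{1}{2r}-\tfrac12\big),\qquad B:=\tfrac{\eta-\beta}{(\mu+1)^2}\Big[\tfrac{(r-1)[2r\mu(\eta-\beta)-(\eta+\mu\beta)]}{2r}+\rho(\mu+1)(2r\mu-1)\Big],$$ $$C:=(r-1)\Big\{\tfrac{(r-1)(\eta+\mu\beta)}{(\mu+1)^2}\Big[\big(\mu-\tfrac1{2r}\big)\eta-\tfrac{(2r+1)\mu\beta}{2r}\Big]-2\rho[\eta-(2r+1)\omega]\Big\},$$ $\hat t_0:=\frac{B+\sqrt{B^2-AC}}{A}$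 if $B^2\ge AC$ and $\hat t_0:=0$ otherwise, and $$t_0:=\max\Big\{\bar t_0,\ \hat t_0,\ r,\ \tfrac{\eta(r-1)}{\eta-\beta},\ \tfrac{\mu}{\omega}(r-1)[\eta-(2r+1)\omega],\ \tfrac{(r-2)\sqrt{\omega r}}{\sqrt{\eta(\mu-1)}}\Big\}.$$ For $k\ge 0$ let $t_k:=k+t_0$ and $$\theta_k:=\tfrac{t_k-r-\mu}{t_{k+1}},\quad \gamma_k:=\tfrac{t_k-r+1}{t_k},\quad \eta_k:=\tfrac{(\eta-\beta)t_k-\delta}{t_{k+1}},\quad \lambda_k:=\tfrac{\eta t_k}{t_{k+1}},\quad \nu_k:=\tfrac{\beta t_k}{t_{k+1}}.$$ Let $(x^k)_{k\ge0}$, $(y^k)_{k\ge0}$, $(u^k)_{k\ge0}$, $(\xi^k)_{k\ge0}$ be sequences in $\mathbb{R}^p$ generated by the scheme (GAEG$_+$): $\xi^k\in Tx^k$ for all $k\ge0$, $u^0=Fx^0$, $y^0=x^0$, and for all $k\ge 0$ $$x^{k+1}=y^k-\eta d^k,\qquad y^{k+1}=x^{k+1}+\theta_k(x^{k+1}-x^k)-p^k,$$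 where $z^k:=u^k+\xi^k$, $\hat w^{k+1}:=Fy^k+\xi^{k+1}$, $d^k:=\hat w^{k+1}-\gamma_kz^k$ and $p^k:=\eta_kz^{k+1}-\lambda_k\hat w^{k+1}+\nu_kz^k$, and the directions $u^k$ satisfy $$\|Fx^{k+1}-u^{k+1}\|^2\le\kappa\|Fx^{k+1}-Fy^k\|^2+\hat\kappa\|d^k\|^2\qquad\text{for all }k\ge0 .$$ Then there is a point $x^\star\in\operatorname{zer}\Phi$ such that $x^k\to x^\star$ and $y^k\to x^\star$ as $k\to\infty$. -/

import Mathlib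

namespace GAEGPlus

noncomputable section

/-! ### Set-valued operators -/

/-- The graph `gra T = {(x, u) : u ∈ T x}` of a set-valued operator. -/
def graph {E : Type*} (T : E → Set E) : Set (E × E) :=
  {q | q.2 ∈ T q.1}

/-- The sum `Φ = F + T` of a single-valued and a set-valued operator, `Φ x = {F x + ξ : ξ ∈ T x}`. -/
def addOp {E : Type*} [Add E] (F : E → E) (T : E → Set E) (x : E) : Set E :=
  {w | ∃ ξ ∈ T x, w = F x + ξ}

/-- The solution set `zer Φ = {x : 0 ∈ Φ x}`. -/
def zer {E : Type*} [Zero E] (Φ : E → Set E) : Set E :=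
  {x | (0 : E) ∈ Φ x}

/-- `Φ` is `ρ`-co-hypomonotone: `⟪u - v, x - y⟫ ≥ -ρ ‖u - v‖²` on the graph of `Φ`. -/
def CoHypomonotone {E : Type*} [NormedAddCommGroup E] [InnerProductSpace ℝ E]
    (ρ : ℝ) (Φ : E → Set E) : Prop :=
  ∀ x u y v : E, (x, u) ∈ graph Φ → (y, v) ∈ graph Φ →
    inner ℝ (u - v) (x - y) ≥ -ρ * ‖u - v‖ ^ 2

/-! ### Parameters of the scheme -/

/-- `β = 8 ρ + 2 ε`. -/
def beta (ρ ε : ℝ) : ℝ := 8 * ρ + 2 * ε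

/-- `δ = (r - 1) β + (r - 2) (η - β) / (μ + 1)`. -/
def delta (r μ η β : ℝ) : ℝ := (r - 1) * β + (r - 2) * (η - β) / (μ + 1)

/-- `ω = μ (η - β) / (μ + 1)`. -/
def omega (μ η β : ℝ) : ℝ := μ * (η - β) / (μ + 1)

/-- `t_k = k + t₀`. -/
def tSeq (t₀ : ℝ) (k : ℕ) : ℝ := (k : ℝ) + t₀

/-- `θ_k = (t_k - r - μ) / t_{k+1}`. -/
def theta (r μ t₀ : ℝ) (k : ℕ) : ℝ := (tSeq t₀ k - r - μ) / tSeq t₀ (k + 1)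

/-- `γ_k = (t_k - r + 1) / t_k`. -/
def gam (r t₀ : ℝ) (k : ℕ) : ℝ := (tSeq t₀ k - r + 1) / tSeq t₀ k

/-- `η_k = ((η - β) t_k - δ) / t_{k+1}`. -/
def etaSeq (r μ η β t₀ : ℝ) (k : ℕ) : ℝ :=
  ((η - β) * tSeq t₀ k - delta r μ η β) / tSeq t₀ (k + 1)

/-- `λ_k = η t_k / t_{k+1}`. -/
def lam (η t₀ : ℝ) (k : ℕ) : ℝ := η * tSeq t₀ k / tSeq t₀ (k + 1)

/-- `ν_k = β t_k / t_{k+1}`. -/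
def nu (β t₀ : ℝ) (k : ℕ) : ℝ := β * tSeq t₀ k / tSeq t₀ (k + 1)

/-! ### The constants `Ψ`, `η̄` and `t₀` (here `ε'` stands for `ε̂` and `κ'` for `κ̂`) -/

/-- `Ψ = (1 - 1/(3r) - κ̂ (12 + 3r + ε̂)) / √(4 + 12 κ + 3 κ r + κ ε̂)`. -/
def Psi (r κ κ' ε' : ℝ) : ℝ :=
  1 / Real.sqrt (4 + 12 * κ + 3 * κ * r + κ * ε') *
    (1 - 1 / (3 * r) - κ' * (12 + 3 * r + ε'))

/-- `η̄ = Ψ / L`. -/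
def etaBar (L r κ κ' ε' : ℝ) : ℝ := Psi r κ κ' ε' / L

/-- `D = 2δ + ω (r + μ - 1)² + 2 Δ r η + 2β + 2 ε̂ η` with `Δ = 3`. -/
def constD (r μ η β ε' : ℝ) : ℝ :=
  2 * delta r μ η β + omega μ η β * (r + μ - 1) ^ 2 + 2 * 3 * r * η + 2 * β + 2 * ε' * η

/-- `E = 4 ρ r (r - 2) + Δ r η + 8 ρ + ε̂ η` with `Δ = 3`. -/
def constE (r η ρ ε' : ℝ) : ℝ :=
  4 * ρ * r * (r - 2) + 3 * r * η + 8 * ρ + ε' * η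

/-- `t̄₀ = (D + √(D² + 4 η E)) / (2 η)`. -/
def tBar (r μ η β ρ ε' : ℝ) : ℝ :=
  (constD r μ η β ε' +
    Real.sqrt (constD r μ η β ε' ^ 2 + 4 * η * constE r η ρ ε')) / (2 * η)

/-- `A = (η - β)² / (μ + 1)² * (μ - 1/(2r) - 1/2)`. -/
def constA (r μ η β : ℝ) : ℝ :=
  (η - β) ^ 2 / (μ + 1) ^ 2 * (μ - 1 / (2 * r) - 1 / 2)

/-- `B = (η - β) / (μ + 1)² *
[(r - 1) (2 r μ (η - β) - (η + μ β)) / (2 r) + ρ (μ + 1) (2 r μ - 1)]`. -/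
def constB (r μ η β ρ : ℝ) : ℝ :=
  (η - β) / (μ + 1) ^ 2 *
    ((r - 1) * (2 * r * μ * (η - β) - (η + μ * β)) / (2 * r) + ρ * (μ + 1) * (2 * r * μ - 1))

/-- `C = (r - 1) {(r - 1) (η + μ β) / (μ + 1)² * [(μ - 1/(2r)) η - (2r + 1) μ β / (2r)]
- 2 ρ [η - (2r + 1) ω]}`. -/
def constC (r μ η β ρ : ℝ) : ℝ :=
  (r - 1) *
    ((r - 1) * (η + μ * β) / (μ + 1) ^ 2 *
        ((μ - 1 / (2 * r)) * η - (2 * r + 1) * μ * β / (2 * r)) -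
      2 * ρ * (η - (2 * r + 1) * omega μ η β))

open Classical in
/-- `t̂₀ = (B + √(B² - A C)) / A` if `B² ≥ A C`, and `t̂₀ = 0` otherwise. -/
def tHat (r μ η β ρ : ℝ) : ℝ :=
  if constA r μ η β * constC r μ η β ρ ≤ constB r μ η β ρ ^ 2 then
    (constB r μ η β ρ +
      Real.sqrt (constB r μ η β ρ ^ 2 - constA r μ η β * constC r μ η β ρ)) / constA r μ η β
  else 0

/-- `t₀ = max {t̄₀, t̂₀, r, η (r-1)/(η-β), (μ/ω) (r-1) [η - (2r+1) ω],
(r-2) √(ω r) / √(η (μ-1))}`. -/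
def tZero (r μ η β ρ ε' : ℝ) : ℝ :=
  max (tBar r μ η β ρ ε') <|
  max (tHat r μ η β ρ) <|
  max r <|
  max (η * (r - 1) / (η - β)) <|
  max (μ / omega μ η β * (r - 1) * (η - (2 * r + 1) * omega μ η β)) <|
    (r - 2) * Real.sqrt (omega μ η β * r) / Real.sqrt (η * (μ - 1))

/-! ### The scheme -/

section Scheme

variable {E : Type*} [NormedAddCommGroup E] [InnerProductSpace ℝ E]

/-- `z^k = u^k + ξ^k`. -/
def zVec (u ξ : ℕ → E) (k : ℕ) : E := u k + ξ k

/-- `ŵ^{k+1} = F y^k + ξ^{k+1}`. -/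
def wHatSucc (F : E → E) (y ξ : ℕ → E) (k : ℕ) : E := F (y k) + ξ (k + 1)

/-- `d^k = ŵ^{k+1} - γ_k z^k`. -/
def dVec (F : E → E) (r t₀ : ℝ) (y u ξ : ℕ → E) (k : ℕ) : E :=
  wHatSucc F y ξ k - gam r t₀ k • zVec u ξ k

/-- `p^k = η_k z^{k+1} - λ_k ŵ^{k+1} + ν_k z^k`. -/
def pVec (F : E → E) (r μ η β t₀ : ℝ) (y u ξ : ℕ → E) (k : ℕ) : E :=
  etaSeq r μ η β t₀ k • zVec u ξ (k + 1) - lam η t₀ k • wHatSucc F y ξ k +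
    nu β t₀ k • zVec u ξ k

/-- The sequences `x, y, u, ξ` are generated by the general scheme (GAEG₊) for `0 ∈ F x + T x`
with parameters `r, μ, η, β`, `t_k = k + t₀`, where the directions `u^k` satisfy
`‖F x^k - u^k‖² ≤ κ ‖F x^k - F y^{k-1}‖² + κ̂ ‖d^{k-1}‖²`.
For `k = 0` this condition holds trivially since `u^0 = F x^0`, so it is only listed for `k + 1`. -/
structure IsGenerated (F : E → E) (T : E → Set E) (r μ η β t₀ κ κ' : ℝ)
    (x y u ξ : ℕ → E) : Prop where
  mem : ∀ k, ξ k ∈ T (x k)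
  u_zero : u 0 = F (x 0)
  y_zero : y 0 = x 0
  x_succ : ∀ k, x (k + 1) = y k - η • dVec F r t₀ y u ξ k
  y_succ : ∀ k, y (k + 1) =
    x (k + 1) + theta r μ t₀ k • (x (k + 1) - x k) - pVec F r μ η β t₀ y u ξ k
  u_cond : ∀ k, ‖F (x (k + 1)) - u (k + 1)‖ ^ 2 ≤
    κ * ‖F (x (k + 1)) - F (y k)‖ ^ 2 + κ' * ‖dVec F r t₀ y u ξ k‖ ^ 2

end Scheme

end

end GAEGPlus

/-! Write w^k = F x^k + ξ^k, e^k = w^k - z^k, Δ = w^{k+1} - w^k, D = x^{k+1} - x^k, f = F x^{k+1} -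
F y^k. The scheme hides a linear recurrence: the vector U_k of `extraVec` satisfies U_{k+1} = U_k -
(r+μ) D - (r-2) ω z^{k+1}. It drives two arguments.

Lyapunov estimate (`exists_energy_step_le`, `IsGenerated.bounded_summable`). The increment of
`energy` is computed exactly. At order t_k² co-hypomonotonicity and the Lipschitz bound leave
negative multiples of ‖d‖² and ‖e‖²; at order t_k there remain negative multiples of ‖D‖² and ‖w‖²;
all other terms are absorbed for large t_k. The one exception is ⟪e^{k+1}, x^k - x⋆⟫, which costs
O(‖x^k - x⋆‖²/t_k²). Since the energy dominates ‖x^k - x⋆‖², this is a summable relative error, so a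
discrete Gronwall argument bounds x^k and makes t_k(‖D‖² + ‖w‖²) and t_k²(‖d‖² + ‖e‖²) summable.

Convergence of the iterates (`IsGenerated.tendsto`). The recurrence is also a contraction of U_k
with factor 1 - (r+μ)/t_k up to summable errors, so U_k → 0. The vector W_k = U_k + (r+μ)(x^k - x⋆)
moves only by -s z^{k+1} with s = (r-2)ω ≥ 0, hence is quasi-Fejér; so ‖x^k - x⋆‖ converges for
every zero x⋆. As w^k → 0 and the graph is closed, a cluster point is a zero, and Opial's argument
concludes. -/

namespace GAEGPlus

open Filter Topology

/-! ### The Lyapunov function and its exact increment. -/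

section Energy

variable {E : Type*} [NormedAddCommGroup E] [InnerProductSpace ℝ E]

theorem inner_le_young {s : ℝ} (hs : 0 < s) (u v : E) :
    inner ℝ u v ≤ s * ‖u‖ ^ 2 + 1 / (4 * s) * ‖v‖ ^ 2 := by
  have h1 := real_inner_le_norm u v
  have h2 : 0 ≤ (2 * s * ‖u‖ - ‖v‖) ^ 2 / (4 * s) := by positivity
  have h3 : (2 * s * ‖u‖ - ‖v‖) ^ 2 / (4 * s) =
      s * ‖u‖ ^ 2 + 1 / (4 * s) * ‖v‖ ^ 2 - ‖u‖ * ‖v‖ := by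
    field_simp
    ring
  linarith

theorem norm_add_sq_le (u v : E) : ‖u + v‖ ^ 2 ≤ 2 * (‖u‖ ^ 2 + ‖v‖ ^ 2) := by
  have := parallelogram_law_with_norm ℝ u v
  nlinarith [sq_nonneg ‖u - v‖]

theorem norm_smul_sq (c : ℝ) (u : E) : ‖c • u‖ ^ 2 = c ^ 2 * ‖u‖ ^ 2 := by
  rw [norm_smul, mul_pow, Real.norm_eq_abs, sq_abs]

/-- The Lyapunov function of the scheme. -/
noncomputable def energy (r μ a K t : ℝ) (V X w e : E) : ℝ :=
  ‖V‖ ^ 2 / 2 + r * μ / 2 * ‖X‖ ^ 2 + μ * a * r * t * inner ℝ w X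
    + μ * a ^ 2 / 2 * t ^ 2 * ‖w‖ ^ 2 + K * t ^ 2 * ‖e‖ ^ 2

/-- The momentum vector entering the Lyapunov function. -/
noncomputable def momentum (r μ a β t : ℝ) (X D w Δ f e : E) : E :=
  t • (D + ((μ + 1) * a + β) • (Δ - f) + β • e + a • w) + r • X

/-- The increment of the momentum vector. -/
noncomputable def momentumStep (r μ a t : ℝ) (D w Δ e₁ : E) : E :=
  -((r - 1) * (μ * a)) • (w + Δ) - μ • D - (μ * a * t) • Δ + ((r - 2) * (μ * a)) • e₁

/-- The lower order part of the increment of the energy. -/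
noncomputable def remainder (r μ a β t : ℝ) (D w Δ f e e₁ : E) : ℝ :=
  -t * inner ℝ (((r - 1) * (μ * a)) • w + μ • D)
      (((μ + 1) * a + β) • (Δ - f) + β • e - (μ * a) • Δ)
    + t * inner ℝ (-((r - 1) * (μ * a)) • Δ + ((r - 2) * (μ * a)) • e₁) (D + a • w)
    + t * inner ℝ (-((r - 1) * (μ * a)) • Δ + ((r - 2) * (μ * a)) • e₁)
      (((μ + 1) * a + β) • (Δ - f) + β • e - (μ * a) • Δ)
    + ‖-((r - 1) * (μ * a)) • (w + Δ) - μ • D + ((r - 2) * (μ * a)) • e₁‖ ^ 2 / 2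
    + r * μ / 2 * ‖D‖ ^ 2
    + μ * a * r * (r - 1) * inner ℝ (w + Δ) D
    + μ * a * r * t * inner ℝ Δ D
    + μ * a ^ 2 / 2 * (2 * t * (2 * inner ℝ w Δ + ‖Δ‖ ^ 2) + ‖w + Δ‖ ^ 2)

/-- The weights of the energy are tuned so that the terms t⟪w, X⟫ and t²⟪w, Δ⟫ cancel. The squares
of Δ produced by the momentum and by ‖w‖² add up to μa(μ+1)a/2, which leaves only -β/2 after ⟪Δ, Δ -
f⟫ is polarized. Both sides are then polynomials in inner products. -/
theorem energy_step_eq (r μ a β K t : ℝ) (X D w Δ f e e₁ : E) :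
    energy r μ a K (t + 1)
        (momentum r μ a β t X D w Δ f e + momentumStep r μ a t D w Δ e₁) (X + D) (w + Δ) e₁
      - energy r μ a K t (momentum r μ a β t X D w Δ f e) X w e
    = -((r - 2) * (μ * a) * r) * inner ℝ (w + Δ) (X + D)
      + (r - 2) * (μ * a) * r * inner ℝ e₁ X
      + μ * a * t ^ 2 * (-inner ℝ Δ D - β / 2 * ‖Δ‖ ^ 2 - β * inner ℝ Δ e
          - ((μ + 1) * a + β) / 2 * ‖Δ - f‖ ^ 2 + ((μ + 1) * a + β) / 2 * ‖f‖ ^ 2)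
      + (K * (t + 1) ^ 2 * ‖e₁‖ ^ 2 - K * t ^ 2 * ‖e‖ ^ 2)
      - μ * t * ‖D‖ ^ 2 - (r - 2) * (μ * a) * a * t * ‖w‖ ^ 2
      + remainder r μ a β t D w Δ f e e₁ := by
  simp only [energy, momentum, momentumStep, remainder, ← real_inner_self_eq_norm_sq,
    inner_add_left, inner_add_right, inner_sub_left, inner_sub_right, inner_smul_left,
    inner_smul_right, RCLike.conj_to_real]
  simp only [
    real_inner_comm X D, real_inner_comm X w, real_inner_comm X Δ, real_inner_comm X f,
    real_inner_comm X e, real_inner_comm X e₁, real_inner_comm D w, real_inner_comm D Δ,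
    real_inner_comm D f, real_inner_comm D e, real_inner_comm D e₁, real_inner_comm w Δ,
    real_inner_comm w f, real_inner_comm w e, real_inner_comm w e₁, real_inner_comm Δ f,
    real_inner_comm Δ e, real_inner_comm Δ e₁, real_inner_comm f e, real_inner_comm f e₁,
    real_inner_comm e e₁]
  ring

end Energy

/-! ### Decrease of the energy for large t. -/

section EnergyStep

variable {E : Type*} [NormedAddCommGroup E] [InnerProductSpace ℝ E]

theorem norm_sub_sq_le (u v : E) : ‖u - v‖ ^ 2 ≤ 2 * (‖u‖ ^ 2 + ‖v‖ ^ 2) := by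
  have := norm_add_sq_le u (-v)
  rwa [← sub_eq_add_neg, norm_neg] at this

theorem norm_smul_add_smul_sq_le (b c : ℝ) (u v : E) :
    ‖b • u + c • v‖ ^ 2 ≤ 2 * (b ^ 2 + c ^ 2) * (‖u‖ ^ 2 + ‖v‖ ^ 2) := by
  have h := norm_add_sq_le (b • u) (c • v)
  rw [norm_smul_sq, norm_smul_sq] at h
  nlinarith [mul_nonneg (sq_nonneg b) (sq_nonneg ‖v‖), mul_nonneg (sq_nonneg c) (sq_nonneg ‖u‖)]

/-- Young's inequality with arbitrarily small weight on N. It pairs the slow quantities N (D and w,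
controlled at order t) with the fast ones G (Δ, f, e, e₁, controlled at order t²). -/
theorem exists_inner_le {σ A B : ℝ} (hσ : 0 < σ) (hA : 0 ≤ A) (hB : 0 ≤ B) :
    ∃ C : ℝ, 0 ≤ C ∧ ∀ (u v : E) (N G : ℝ), 0 ≤ N → 0 ≤ G → ‖u‖ ^ 2 ≤ A * N →
      ‖v‖ ^ 2 ≤ B * G → inner ℝ u v ≤ σ * N + C * G := by
  have hs : 0 < σ / (A + 1) := by positivity
  refine ⟨1 / (4 * (σ / (A + 1))) * B, by positivity, fun u v N G hN hG hu hv => ?_⟩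
  have h := inner_le_young hs u v
  have h1 : σ / (A + 1) * ‖u‖ ^ 2 ≤ σ * N := by
    calc σ / (A + 1) * ‖u‖ ^ 2 ≤ σ / (A + 1) * (A * N) := by gcongr
      _ = σ * N * (A / (A + 1)) := by ring
      _ ≤ σ * N * 1 := by
        gcongr
        exact (div_le_one (by positivity)).2 (by linarith)
      _ = σ * N := mul_one _
  have h2 : 1 / (4 * (σ / (A + 1))) * ‖v‖ ^ 2 ≤ 1 / (4 * (σ / (A + 1))) * (B * G) := by gcongr
  linarith

/-- Every term carrying a factor t contains at least one fast vector, so Young leaves just σt on the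
slow ones; slow-slow products occur only without the factor t. -/
theorem exists_remainder_le {r μ a β σ : ℝ} (hr : 2 < r) (hμ : 0 < μ) (ha : 0 < a) (hσ : 0 < σ) :
    ∃ C : ℝ, 0 ≤ C ∧ ∀ (t : ℝ) (D w Δ f e e₁ : E), 1 ≤ t →
      remainder r μ a β t D w Δ f e e₁ ≤ σ * t * (‖D‖ ^ 2 + ‖w‖ ^ 2)
        + C * t * (‖Δ‖ ^ 2 + ‖f‖ ^ 2 + ‖e‖ ^ 2 + ‖e₁‖ ^ 2) + C * (‖D‖ ^ 2 + ‖w‖ ^ 2) := by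
  set ω := μ * a with hω
  set η := (μ + 1) * a + β with hη
  have hω0 : 0 < ω := mul_pos hμ ha
  obtain ⟨A₁, hA₁, H₁⟩ : ∃ A : ℝ, 0 ≤ A ∧ ∀ D w : E,
      ‖-(((r - 1) * ω) • w + μ • D)‖ ^ 2 ≤ A * (‖D‖ ^ 2 + ‖w‖ ^ 2) := by
    refine ⟨2 * (((r - 1) * ω) ^ 2 + μ ^ 2), by positivity, fun D w => ?_⟩
    rw [norm_neg, add_comm (‖D‖ ^ 2)]
    exact norm_smul_add_smul_sq_le _ _ _ _
  obtain ⟨A₂, hA₂, H₂⟩ : ∃ A : ℝ, 0 ≤ A ∧ ∀ D w : E,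
      ‖D + a • w‖ ^ 2 ≤ A * (‖D‖ ^ 2 + ‖w‖ ^ 2) := by
    refine ⟨2 * (1 ^ 2 + a ^ 2), by positivity, fun D w => ?_⟩
    simpa using norm_smul_add_smul_sq_le 1 a D w
  obtain ⟨B₁, hB₁, H₃⟩ : ∃ A : ℝ, 0 ≤ A ∧ ∀ Δ f e e₁ : E,
      ‖-((r - 1) * ω) • Δ + ((r - 2) * ω) • e₁‖ ^ 2 ≤
        A * (‖Δ‖ ^ 2 + ‖f‖ ^ 2 + ‖e‖ ^ 2 + ‖e₁‖ ^ 2) := by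
    refine ⟨2 * ((-((r - 1) * ω)) ^ 2 + ((r - 2) * ω) ^ 2), by positivity, fun Δ f e e₁ => ?_⟩
    refine (norm_smul_add_smul_sq_le _ _ _ _).trans ?_
    gcongr
    linarith [sq_nonneg ‖f‖, sq_nonneg ‖e‖]
  obtain ⟨B₂, hB₂, H₄⟩ : ∃ A : ℝ, 0 ≤ A ∧ ∀ Δ f e e₁ : E,
      ‖η • (Δ - f) + β • e - ω • Δ‖ ^ 2 ≤
        A * (‖Δ‖ ^ 2 + ‖f‖ ^ 2 + ‖e‖ ^ 2 + ‖e₁‖ ^ 2) := by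
    refine ⟨4 * ((η - ω) ^ 2 + (-η) ^ 2) + 2 * β ^ 2, by positivity, fun Δ f e e₁ => ?_⟩
    have e0 : η • (Δ - f) + β • e - ω • Δ = ((η - ω) • Δ + (-η) • f) + β • e := by module
    rw [e0]
    have h1 := norm_add_sq_le ((η - ω) • Δ + (-η) • f) (β • e)
    have h2 := norm_smul_add_smul_sq_le (η - ω) (-η) Δ f
    rw [norm_smul_sq β e] at h1
    have h3 : 0 ≤ (4 * ((η - ω) ^ 2 + (-η) ^ 2)) * (‖e‖ ^ 2 + ‖e₁‖ ^ 2) := by positivity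
    have h4 : 0 ≤ 2 * β ^ 2 * (‖Δ‖ ^ 2 + ‖f‖ ^ 2 + ‖e₁‖ ^ 2) := by positivity
    linarith
  have hσ4 : 0 < σ / 4 := by positivity
  obtain ⟨C₁, hC₁, K₁⟩ := exists_inner_le (E := E) hσ4 hA₁ hB₂
  obtain ⟨C₂, hC₂, K₂⟩ := exists_inner_le (E := E) hσ4 hA₂ hB₁
  obtain ⟨C₃, hC₃, K₃⟩ := exists_inner_le (E := E) one_pos hB₁ hB₂
  obtain ⟨C₄, hC₄, K₄⟩ := exists_inner_le (E := E) (A := 1) (B := (ω * r) ^ 2) hσ4 zero_le_one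
    (by positivity)
  obtain ⟨C₅, hC₅, K₅⟩ := exists_inner_le (E := E) (A := 1) (B := (2 * μ * a ^ 2) ^ 2) hσ4
    zero_le_one (by positivity)
  set S := ω * r * (r - 1) with hS
  have hS0 : 0 ≤ S := by
    have : 0 ≤ r - 1 := by linarith
    positivity
  refine ⟨C₁ + C₂ + (1 + C₃) + C₄ + C₅ + (2 * A₁ + 2 * B₁) / 2 + r * μ / 2 + 2 * S
    + 2 * (μ * a ^ 2), by positivity, fun t D w Δ f e e₁ ht => ?_⟩
  have ht0 : 0 ≤ t := by linarith
  set N := ‖D‖ ^ 2 + ‖w‖ ^ 2 with hN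
  set G := ‖Δ‖ ^ 2 + ‖f‖ ^ 2 + ‖e‖ ^ 2 + ‖e₁‖ ^ 2 with hG
  have hN0 : 0 ≤ N := by positivity
  have hG0 : 0 ≤ G := by positivity
  have hΔG : ‖Δ‖ ^ 2 ≤ G := by rw [hG]; linarith [sq_nonneg ‖f‖, sq_nonneg ‖e‖, sq_nonneg ‖e₁‖]
  have hDN : ‖D‖ ^ 2 ≤ N := by rw [hN]; linarith [sq_nonneg ‖w‖]
  have hwN : ‖w‖ ^ 2 ≤ N := by rw [hN]; linarith [sq_nonneg ‖D‖]
  have k₁ := K₁ _ _ N G hN0 hG0 (H₁ D w) (H₄ Δ f e e₁)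
  have k₂ := K₂ _ _ N G hN0 hG0 (H₂ D w) (H₃ Δ f e e₁)
  have k₃ := K₃ _ _ G G hG0 hG0 (H₃ Δ f e e₁) (H₄ Δ f e e₁)
  have k₄ := K₄ D ((ω * r) • Δ) N G hN0 hG0 (by linarith) (by rw [norm_smul_sq]; gcongr)
  have k₅ := K₅ w ((2 * μ * a ^ 2) • Δ) N G hN0 hG0 (by linarith) (by rw [norm_smul_sq]; gcongr)
  rw [inner_neg_left] at k₁
  rw [real_inner_comm] at k₂
  rw [real_inner_comm, inner_smul_left, RCLike.conj_to_real] at k₄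
  rw [inner_smul_right] at k₅
  have k₆ : ‖-((r - 1) * ω) • (w + Δ) - μ • D + ((r - 2) * ω) • e₁‖ ^ 2 ≤
      2 * (A₁ * N + B₁ * G) := by
    have e0 : -((r - 1) * ω) • (w + Δ) - μ • D + ((r - 2) * ω) • e₁ =
      -(((r - 1) * ω) • w + μ • D) + (-((r - 1) * ω) • Δ + ((r - 2) * ω) • e₁) := by module
    rw [e0]
    refine (norm_add_sq_le _ _).trans ?_
    linarith [H₁ D w, H₃ Δ f e e₁]
  have k₇ : ‖w + Δ‖ ^ 2 ≤ 2 * (N + G) := by linarith [norm_add_sq_le w Δ]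
  have k₈ : inner ℝ (w + Δ) D ≤ 2 * (N + G) := by
    have := inner_le_young (s := 1 / 2) (by norm_num) (w + Δ) D
    norm_num at this
    linarith
  have l₁ := mul_le_mul_of_nonneg_left k₁ ht0
  have l₂ := mul_le_mul_of_nonneg_left k₂ ht0
  have l₃ := mul_le_mul_of_nonneg_left k₃ ht0
  have l₄ := mul_le_mul_of_nonneg_left k₄ ht0
  have l₅ := mul_le_mul_of_nonneg_left k₅ ht0
  have l₈ := mul_le_mul_of_nonneg_left k₈ hS0
  have hμa : 0 ≤ μ * a ^ 2 := by positivity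
  have l₇ := mul_le_mul_of_nonneg_left k₇ hμa
  have l₉ := mul_le_mul_of_nonneg_left hΔG (mul_nonneg hμa ht0)
  have l₁₀ := mul_le_mul_of_nonneg_left hDN (mul_nonneg (by linarith : 0 ≤ r) hμ.le)
  have hGt : G ≤ t * G := le_mul_of_one_le_left hG0 ht
  have m₁ := mul_le_mul_of_nonneg_left hGt hB₁
  have m₂ := mul_le_mul_of_nonneg_left hGt hS0
  have m₃ := mul_le_mul_of_nonneg_left hGt hμa
  have n₁ : 0 ≤ (C₁ + C₂ + (1 + C₃) + C₄ + C₅ + B₁ + μ * a ^ 2) * N := by positivity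
  have n₂ : 0 ≤ (A₁ + r * μ / 2) * (t * G) := by
    have : 0 ≤ r := by linarith
    positivity
  have hrem : remainder r μ a β t D w Δ f e e₁ =
      t * (-inner ℝ (((r - 1) * ω) • w + μ • D) (η • (Δ - f) + β • e - ω • Δ))
      + t * inner ℝ (-((r - 1) * ω) • Δ + ((r - 2) * ω) • e₁) (D + a • w)
      + t * inner ℝ (-((r - 1) * ω) • Δ + ((r - 2) * ω) • e₁)
        (η • (Δ - f) + β • e - ω • Δ)
      + ‖-((r - 1) * ω) • (w + Δ) - μ • D + ((r - 2) * ω) • e₁‖ ^ 2 / 2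
      + r * μ * ‖D‖ ^ 2 / 2
      + S * inner ℝ (w + Δ) D
      + t * (ω * r * inner ℝ Δ D)
      + t * (2 * μ * a ^ 2 * inner ℝ w Δ) + μ * a ^ 2 * t * ‖Δ‖ ^ 2
      + μ * a ^ 2 * ‖w + Δ‖ ^ 2 / 2 := by
    simp only [remainder, ← hω, ← hη, hS]
    ring
  rw [hrem]
  linarith

-- Terms are compared by order in t: a negative multiple of t² on ‖d‖² and ‖e‖², and of t on ‖D‖²
-- and ‖w‖², beats everything of lower order once t is large. The vector Δ is controlled through d,
-- f, e and the O(1/t) correction in d.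
set_option maxHeartbeats 1000000 in
theorem exists_energy_step_le {r μ a β ρ M κ κ' : ℝ} (hr : 2 < r) (hμ : 0 < μ) (ha : 0 < a)
    (hρ : 0 ≤ ρ) (hβ : 8 * ρ ≤ β) (hM : 0 ≤ M) (hκ : 0 ≤ κ) (hκ' : 0 ≤ κ')
    (hsmall : 4 * M + 18 * (κ * M + κ') < 1) :
    ∃ c C T : ℝ, 0 < c ∧ 0 ≤ C ∧ 1 ≤ T ∧ ∀ (t : ℝ) (X D w Δ f e e₁ d : E), T ≤ t →
      d = Δ - f + e + ((r - 1) / t) • (w - e) →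
      ‖f‖ ^ 2 ≤ M * ‖d‖ ^ 2 → ‖e₁‖ ^ 2 ≤ κ * ‖f‖ ^ 2 + κ' * ‖d‖ ^ 2 →
      -inner ℝ Δ D ≤ ρ * ‖Δ‖ ^ 2 → -inner ℝ (w + Δ) (X + D) ≤ ρ * ‖w + Δ‖ ^ 2 →
      energy r μ a (2 * (μ * a) * ((μ + 1) * a + β)) (t + 1)
          (momentum r μ a β t X D w Δ f e + momentumStep r μ a t D w Δ e₁) (X + D) (w + Δ) e₁
        ≤ energy r μ a (2 * (μ * a) * ((μ + 1) * a + β)) t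
            (momentum r μ a β t X D w Δ f e) X w e
          + C / t ^ 2 * ‖X‖ ^ 2
          - c * (t * (‖D‖ ^ 2 + ‖w‖ ^ 2) + t ^ 2 * (‖d‖ ^ 2 + ‖e‖ ^ 2)) := by
  have hβ0 : 0 ≤ β := by linarith
  have hω0 : 0 < μ * a := mul_pos hμ ha
  have hη0 : 0 < (μ + 1) * a + β := by positivity
  have hβη : β ≤ (μ + 1) * a + β := by
    have : 0 < (μ + 1) * a := by positivity
    linarith
  set m := min μ ((r - 2) * (μ * a) * a) with hm
  have hm0 : 0 < m := lt_min hμ (by have : 0 < r - 2 := by linarith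
                                    positivity)
  have hm1 : m ≤ μ := min_le_left _ _
  have hm2 : m ≤ (r - 2) * (μ * a) * a := min_le_right _ _
  -- The remainder takes half of the decrease m t N; the threshold on t spends another quarter on
  -- the C₂ terms, leaving m / 4.
  obtain ⟨C₀, hC₀, H₀⟩ := exists_remainder_le (E := E) (β := β) hr hμ ha (half_pos hm0)
  set ω := μ * a with hω
  set η := (μ + 1) * a + β with hη
  set q := (r - 2) * ω * r with hq
  have hq0 : 0 < q := by
    have : 0 < r - 2 := by linarith
    positivity
  set c₁ := ω * η / 16 with hc₁
  have hc₁0 : 0 < c₁ := by positivity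
  set c₀ := 8 + 8 * (r - 1) ^ 2 with hc₀
  have hc₀0 : 0 < c₀ := by positivity
  set C₂ := C₀ * (c₀ + 2) + C₀ + 2 * (ω * η) * (r - 1) ^ 2 + 6 * (ω * η)
    + 2 * q * ρ * (1 + c₀) with hC₂
  have hC₂0 : 0 ≤ C₂ := by positivity
  refine ⟨min (m / 4) (c₁ / 2), q ^ 2 / (4 * c₁), 1 + 4 * C₂ / m + 2 * C₂ / c₁,
    lt_min (by positivity) (by positivity), by positivity, ?_, ?_⟩
  · have : 0 ≤ 4 * C₂ / m + 2 * C₂ / c₁ := by positivity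
    linarith
  intro t X D w Δ f e e₁ d hT hd hf he₁ hmono hmono'
  have h4 : 0 ≤ 4 * C₂ / m := by positivity
  have h2 : 0 ≤ 2 * C₂ / c₁ := by positivity
  have ht : 1 ≤ t := by linarith
  have ht0 : 0 < t := by linarith
  have htm : C₂ ≤ m / 4 * t := by
    have : 4 * C₂ / m ≤ t := by linarith
    rw [div_le_iff₀ hm0] at this
    linarith
  have htc : C₂ ≤ c₁ / 2 * t := by
    have : 2 * C₂ / c₁ ≤ t := by linarith
    rw [div_le_iff₀ hc₁0] at this
    linarith
  set N := ‖D‖ ^ 2 + ‖w‖ ^ 2 with hN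
  set G := ‖d‖ ^ 2 + ‖e‖ ^ 2 with hG
  have hN0 : 0 ≤ N := by positivity
  have hG0 : 0 ≤ G := by positivity
  have hwN : ‖w‖ ^ 2 ≤ N := by rw [hN]; linarith [sq_nonneg ‖D‖]
  have hdG : ‖d‖ ^ 2 ≤ G := by rw [hG]; linarith [sq_nonneg ‖e‖]
  have heG : ‖e‖ ^ 2 ≤ G := by rw [hG]; linarith [sq_nonneg ‖d‖]
  have hd0 := sq_nonneg ‖d‖
  have hE0 : 0 ≤ κ * M + κ' := by positivity
  have he₁' : ‖e₁‖ ^ 2 ≤ (κ * M + κ') * ‖d‖ ^ 2 := by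
    have := mul_le_mul_of_nonneg_left hf hκ
    linarith
  have he₁d : ‖e₁‖ ^ 2 ≤ ‖d‖ ^ 2 :=
    he₁'.trans (mul_le_of_le_one_left hd0 (by linarith))
  have hfd : ‖f‖ ^ 2 ≤ ‖d‖ ^ 2 := hf.trans (mul_le_of_le_one_left hd0 (by linarith))
  -- the correction term `h`
  obtain ⟨h, hh⟩ : ∃ h : E, h = ((r - 1) / t) • (w - e) := ⟨_, rfl⟩
  have hh2 : t ^ 2 * ‖h‖ ^ 2 ≤ 2 * (r - 1) ^ 2 * (N + G) := by
    have e0 : t ^ 2 * ‖h‖ ^ 2 = (r - 1) ^ 2 * ‖w - e‖ ^ 2 := by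
      rw [hh, norm_smul_sq]
      field_simp
    rw [e0]
    have h1 := norm_sub_sq_le w e
    have h3 : ‖w - e‖ ^ 2 ≤ 2 * (N + G) := by linarith only [h1, hwN, heG]
    have h5 := mul_le_mul_of_nonneg_left h3 (sq_nonneg (r - 1))
    linarith only [h5]
  rw [← hh] at hd
  have hΔf : -‖Δ - f‖ ^ 2 ≤ -(1 / 2) * ‖d‖ ^ 2 + 2 * ‖e‖ ^ 2 + 2 * ‖h‖ ^ 2 := by
    have h1 := norm_add_sq_le (Δ - f) (e + h)
    have h3 := norm_add_sq_le e h
    have : d = (Δ - f) + (e + h) := by rw [hd]; abel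
    rw [← this] at h1
    linarith only [h1, h3]
  have hΔ : t * ‖Δ‖ ^ 2 ≤ c₀ * (t * G + N) := by
    have e0 : Δ = (d + f) - (e + h) := by rw [hd]; abel
    have h1 := norm_sub_sq_le (d + f) (e + h)
    have h3 := norm_add_sq_le d f
    have h5 := norm_add_sq_le e h
    rw [← e0] at h1
    have h6 : ‖Δ‖ ^ 2 ≤ 8 * G + 4 * ‖h‖ ^ 2 := by
      rw [hG]
      linarith only [h1, h3, h5, hfd, sq_nonneg ‖e‖]
    have h7 := mul_le_mul_of_nonneg_left h6 ht0.le
    have h8 : t * ‖h‖ ^ 2 ≤ t ^ 2 * ‖h‖ ^ 2 := by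
      gcongr
      exact le_self_pow₀ ht two_ne_zero
    have h9 : N + G ≤ t * G + N := by
      linarith only [le_mul_of_one_le_left hG0 ht]
    have h10 := mul_le_mul_of_nonneg_left h9 (sq_nonneg (r - 1))
    rw [hc₀]
    linarith only [h7, h8, h10, hh2, hN0]
  have hΔ1 : ‖Δ‖ ^ 2 ≤ c₀ * (t * G + N) :=
    (le_mul_of_one_le_left (sq_nonneg _) ht).trans hΔ
  -- leading order bracket
  have hbr : -inner ℝ Δ D - β / 2 * ‖Δ‖ ^ 2 - β * inner ℝ Δ e
      - η / 2 * ‖Δ - f‖ ^ 2 + η / 2 * ‖f‖ ^ 2 ≤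
      η / 2 * (10 / 3 * ‖e‖ ^ 2 - (1 / 2 - M) * ‖d‖ ^ 2 + 2 * ‖h‖ ^ 2) := by
    -- The weight 3/8 plus the 1/8 coming from ρ ≤ β/8 uses up exactly the available β/2 ‖Δ‖².
    have h1 := inner_le_young (s := 3 / 8) (by norm_num) Δ (-e)
    rw [inner_neg_right, norm_neg] at h1
    norm_num at h1
    have h3 := mul_le_mul_of_nonneg_left h1 hβ0
    have h5 := mul_le_mul_of_nonneg_left hΔf (half_pos hη0).le
    have h6 := mul_le_mul_of_nonneg_left hf (half_pos hη0).le
    have h7 := mul_le_mul_of_nonneg_right hβη (sq_nonneg ‖e‖)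
    have h8 := mul_le_mul_of_nonneg_right hβ (sq_nonneg ‖Δ‖)
    linarith only [hmono, h3, h5, h6, h7, h8]
  have hbr' := mul_le_mul_of_nonneg_left hbr (by positivity : 0 ≤ ω * t ^ 2)
  have hK : 2 * ω * η * (t + 1) ^ 2 * ‖e₁‖ ^ 2 ≤
      2 * ω * η * t ^ 2 * ((κ * M + κ') * ‖d‖ ^ 2) + 6 * (ω * η) * (t * G) := by
    have h1 : (t + 1) ^ 2 ≤ t ^ 2 + 3 * t := by linarith only [ht]
    have h3 : (t + 1) ^ 2 * ‖e₁‖ ^ 2 ≤ t ^ 2 * ((κ * M + κ') * ‖d‖ ^ 2) + 3 * t * G := by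
      calc (t + 1) ^ 2 * ‖e₁‖ ^ 2 ≤ (t ^ 2 + 3 * t) * ‖e₁‖ ^ 2 := by gcongr
        _ = t ^ 2 * ‖e₁‖ ^ 2 + 3 * t * ‖e₁‖ ^ 2 := by ring
        _ ≤ t ^ 2 * ((κ * M + κ') * ‖d‖ ^ 2) + 3 * t * G := by
          gcongr
          exact he₁d.trans hdG
    have := mul_le_mul_of_nonneg_left h3 (by positivity : 0 ≤ 2 * ω * η)
    linarith only [this]
  -- The sole term involving X that monotonicity does not control; weight t² in Young makes its cost
  -- in ‖X‖² summable.
  have hnuis : q * inner ℝ e₁ X ≤ c₁ * (t ^ 2 * ‖d‖ ^ 2) + q ^ 2 / (4 * c₁) / t ^ 2 * ‖X‖ ^ 2 := by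
    have h1 := inner_le_young (s := c₁ / q * t ^ 2) (by positivity) e₁ X
    have h3 := mul_le_mul_of_nonneg_left h1 hq0.le
    have e0 : q * (c₁ / q * t ^ 2 * ‖e₁‖ ^ 2 + 1 / (4 * (c₁ / q * t ^ 2)) * ‖X‖ ^ 2) =
        c₁ * (t ^ 2 * ‖e₁‖ ^ 2) + q ^ 2 / (4 * c₁) / t ^ 2 * ‖X‖ ^ 2 := by
      field_simp
    rw [e0] at h3
    have h5 : c₁ * (t ^ 2 * ‖e₁‖ ^ 2) ≤ c₁ * (t ^ 2 * ‖d‖ ^ 2) := by gcongr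
    linarith only [h3, h5]
  have hmon : -q * inner ℝ (w + Δ) (X + D) ≤ 2 * q * ρ * (1 + c₀) * (t * G + N) := by
    have h1 := mul_le_mul_of_nonneg_left hmono' hq0.le
    have h3 : ‖w + Δ‖ ^ 2 ≤ 2 * ((1 + c₀) * (t * G + N)) := by
      have h5 := norm_add_sq_le w Δ
      have h6 : 0 ≤ t * G := by positivity
      linarith only [h5, h6, hwN, hΔ1]
    have h5 := mul_le_mul_of_nonneg_left h3 (by positivity : 0 ≤ q * ρ)
    linarith only [h1, h5]
  have hrem := H₀ t D w Δ f e e₁ ht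
  have hrem' : C₀ * t * (‖Δ‖ ^ 2 + ‖f‖ ^ 2 + ‖e‖ ^ 2 + ‖e₁‖ ^ 2) ≤
      C₀ * (c₀ + 2) * (t * G + N) := by
    have h1 : ‖f‖ ^ 2 + ‖e‖ ^ 2 + ‖e₁‖ ^ 2 ≤ 2 * G := by
      rw [hG]; linarith only [hfd, he₁d, sq_nonneg ‖e‖]
    have h3 := mul_le_mul_of_nonneg_left h1 ht0.le
    have h5 : t * (‖Δ‖ ^ 2 + ‖f‖ ^ 2 + ‖e‖ ^ 2 + ‖e₁‖ ^ 2) ≤ (c₀ + 2) * (t * G + N) := by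
      linarith only [h3, hΔ, hN0]
    have := mul_le_mul_of_nonneg_left h5 hC₀
    linarith only [this]
  have heq := energy_step_eq r μ a β (2 * ω * η) t X D w Δ f e e₁
  rw [← hω, ← hη, ← hq] at heq
  have hslow : m * t * N ≤ μ * t * ‖D‖ ^ 2 + (r - 2) * ω * a * t * ‖w‖ ^ 2 := by
    have h1 := mul_le_mul_of_nonneg_right hm1 (by positivity : 0 ≤ t * ‖D‖ ^ 2)
    have h3 := mul_le_mul_of_nonneg_right hm2 (by positivity : 0 ≤ t * ‖w‖ ^ 2)
    rw [hN]
    linarith only [h1, h3]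
  have htG : G ≤ t * G := le_mul_of_one_le_left hG0 ht
  have hh3 := mul_le_mul_of_nonneg_left hh2 (by positivity : 0 ≤ ω * η)
  -- In units of ωηt², the weight K gives -2 against 5/3 for ‖e‖². For ‖d‖² the margin c₁ remains
  -- when M + 4(κM + κ') ≤ 1/4, which `hsmall` implies.
  have hquad : ω * t ^ 2 * (η / 2 * (10 / 3 * ‖e‖ ^ 2 - (1 / 2 - M) * ‖d‖ ^ 2 + 2 * ‖h‖ ^ 2))
      + 2 * ω * η * t ^ 2 * ((κ * M + κ') * ‖d‖ ^ 2) - 2 * ω * η * t ^ 2 * ‖e‖ ^ 2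
      + c₁ * (t ^ 2 * ‖d‖ ^ 2)
      ≤ -c₁ * (t ^ 2 * G) + 2 * (ω * η) * (r - 1) ^ 2 * (t * G + N) := by
    have h1 : 0 ≤ ω * η * t ^ 2 * ‖d‖ ^ 2 * (1 / 4 - M - 4 * (κ * M + κ')) := by
      have : 0 ≤ 1 / 4 - M - 4 * (κ * M + κ') := by linarith only [hsmall, hE0]
      positivity
    have h3 : 0 ≤ ω * η * t ^ 2 * ‖e‖ ^ 2 := by positivity
    have h5 : 2 * (ω * η) * (r - 1) ^ 2 * (N + G) ≤ 2 * (ω * η) * (r - 1) ^ 2 * (t * G + N) := by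
      refine mul_le_mul_of_nonneg_left ?_ (by positivity)
      linarith only [htG]
    rw [hG] at h5 hh3 ⊢
    rw [hc₁]
    linarith only [h1, h3, h5, hh3]
  have hC₂N : C₀ * N ≤ C₀ * (t * G + N) := by
    gcongr
    linarith only [mul_nonneg ht0.le hG0]
  have htot : 6 * (ω * η) * (t * G) ≤ 6 * (ω * η) * (t * G + N) := by
    gcongr
    linarith only [hN0]
  have f₁ := mul_le_mul_of_nonneg_right htm hN0
  have f₂ := mul_le_mul_of_nonneg_right htc (by positivity : 0 ≤ t * G)
  have fin : min (m / 4) (c₁ / 2) * (t * N + t ^ 2 * G) ≤ m / 4 * (t * N) + c₁ / 2 * (t ^ 2 * G) := by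
    rw [mul_add]
    gcongr
    · exact min_le_left _ _
    · exact min_le_right _ _
  have hsum : C₂ * (t * G + N) = C₀ * (c₀ + 2) * (t * G + N) + C₀ * (t * G + N)
      + 2 * (ω * η) * (r - 1) ^ 2 * (t * G + N) + 6 * (ω * η) * (t * G + N)
      + 2 * q * ρ * (1 + c₀) * (t * G + N) := by
    rw [hC₂]; ring
  linarith only [heq, hbr', hK, hnuis, hmon, hrem, hrem', hslow, hquad, hC₂N, htot, f₁, f₂, fin, hsum]

end EnergyStep

/-! ### Quasi-Fejér and Gronwall lemmas for real sequences. -/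

section RealSequences

theorem quasi_fejer {a b q : ℕ → ℝ} (ha : ∀ k, 0 ≤ a k) (hb : ∀ k, 0 ≤ b k) (hq : Summable q)
    (h : ∀ k, a (k + 1) ≤ a k - b k + q k) :
    (∃ ℓ, Tendsto a atTop (𝓝 ℓ)) ∧ Summable b := by
  set S : ℕ → ℝ := fun k => ∑ i ∈ Finset.range k, q i with hS
  have hSt : Tendsto S atTop (𝓝 (∑' i, q i)) := hq.hasSum.tendsto_sum_nat
  obtain ⟨s, hs⟩ := hSt.bddAbove_range
  have hsS : ∀ k, S k ≤ s := fun k => hs ⟨k, rfl⟩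
  have hSs : ∀ k, S (k + 1) = S k + q k := fun k => Finset.sum_range_succ _ _
  constructor
  · have hanti : Antitone fun k => a k - S k :=
      antitone_nat_of_succ_le fun k => by rw [hSs]; linarith [h k, hb k]
    have hbdd : BddBelow (Set.range fun k => a k - S k) :=
      ⟨-s, by rintro _ ⟨k, rfl⟩; dsimp only; linarith [ha k, hsS k]⟩
    refine ⟨_, ((tendsto_atTop_ciInf hanti hbdd).add hSt).congr fun k => ?_⟩
    ring
  · refine summable_of_sum_range_le (c := a 0 + s) hb fun n => ?_
    have key : ∑ i ∈ Finset.range n, b i ≤ a 0 - a n + S n := by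
      induction n with
      | zero => simp [hS]
      | succ n ih => rw [Finset.sum_range_succ, hSs]; linarith [h n]
    linarith [ha n, hsS n]

/-- Multiplying a_k by 1 + 3C/t_k turns the growth factor into plain descent: the loss 3C/(t(t+1))
of this weight outweighs C/t² when t ≥ 1 + 3C. -/
theorem bounded_summable_of_le_one_add_div_sq {a b : ℕ → ℝ} {C t₀ : ℝ} (hC : 0 ≤ C)
    (ht₀ : 1 + 3 * C ≤ t₀) (ha : ∀ k, 0 ≤ a k) (hb : ∀ k, 0 ≤ b k)
    (h : ∀ k, a (k + 1) ≤ (1 + C / tSeq t₀ k ^ 2) * a k - b k) :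
    (∃ A, ∀ k, a k ≤ A) ∧ Summable b := by
  have htge : ∀ k, 1 + 3 * C ≤ tSeq t₀ k := fun k => by
    have : (0 : ℝ) ≤ k := k.cast_nonneg
    rw [tSeq]; linarith
  have htpos : ∀ k, 0 < tSeq t₀ k := fun k => by linarith [htge k]
  have htsucc : ∀ k, tSeq t₀ (k + 1) = tSeq t₀ k + 1 := fun k => by
    simp only [tSeq]; push_cast; ring
  have hstep : ∀ k, (1 + 3 * C / tSeq t₀ (k + 1)) * a (k + 1) ≤
      (1 + 3 * C / tSeq t₀ k) * a k - b k + 0 := fun k => by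
    have htk := htpos k
    have hge := htge k
    have hk := h k
    rw [htsucc]
    generalize tSeq t₀ k = t at *
    have h1 : (1 + 3 * C / (t + 1)) * (1 + C / t ^ 2) ≤ 1 + 3 * C / t := by
      rw [← sub_nonneg]
      have : 1 + 3 * C / t - (1 + 3 * C / (t + 1)) * (1 + C / t ^ 2) =
          C * (2 * t - 1 - 3 * C) / (t ^ 2 * (t + 1)) := by
        field_simp; ring
      rw [this]
      have : 0 ≤ 2 * t - 1 - 3 * C := by linarith
      positivity
    have h2 : 0 ≤ 3 * C / (t + 1) := by positivity
    have h3 := mul_le_mul_of_nonneg_left hk (by linarith : 0 ≤ 1 + 3 * C / (t + 1))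
    have h4 := mul_le_mul_of_nonneg_right h1 (ha k)
    have h5 := mul_nonneg h2 (hb k)
    linarith
  have hpos : ∀ k, 0 ≤ 3 * C / tSeq t₀ k := fun k => by
    have := htpos k
    positivity
  obtain ⟨⟨ℓ, hℓ⟩, hsum⟩ := quasi_fejer (a := fun k => (1 + 3 * C / tSeq t₀ k) * a k)
    (q := fun _ => 0) (fun k => mul_nonneg (by linarith [hpos k]) (ha k)) hb summable_zero hstep
  obtain ⟨A, hA⟩ := hℓ.bddAbove_range
  refine ⟨⟨A, fun k => le_trans ?_ (hA ⟨k, rfl⟩)⟩, hsum⟩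
  have := mul_nonneg (hpos k) (ha k)
  dsimp only
  linarith

theorem summable_one_div_tSeq_sq {t₀ : ℝ} (ht₀ : 0 < t₀) :
    Summable fun k => 1 / tSeq t₀ k ^ 2 := by
  refine ((Real.summable_one_div_nat_add_rpow t₀ 2).2 one_lt_two).congr fun k => ?_
  have : 0 < (k : ℝ) + t₀ := by positivity
  rw [abs_of_pos this, Real.rpow_two, tSeq]

theorem not_summable_one_div_tSeq {t₀ : ℝ} (ht₀ : 0 < t₀) :
    ¬ Summable fun k => 1 / tSeq t₀ k := by
  intro h
  refine lt_irrefl (1 : ℝ) ((Real.summable_one_div_nat_add_rpow t₀ 1).1 (h.congr fun k => ?_))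
  have : 0 < (k : ℝ) + t₀ := by positivity
  rw [abs_of_pos this, Real.rpow_one, tSeq]

/-- A positive limit would make the series dominate a multiple of the divergent ∑ 1/t_k. -/
theorem tendsto_zero_of_summable_div_tSeq {p : ℕ → ℝ} {t₀ ℓ : ℝ} (ht₀ : 0 < t₀)
    (hp : ∀ k, 0 ≤ p k) (hℓ : Tendsto p atTop (𝓝 ℓ))
    (hs : Summable fun k => p k / tSeq t₀ k) : Tendsto p atTop (𝓝 0) := by
  have h0 : 0 ≤ ℓ := ge_of_tendsto' hℓ hp
  rcases h0.eq_or_lt with h | h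
  · rwa [h]
  · exfalso
    obtain ⟨K, hK⟩ := eventually_atTop.1 (hℓ.eventually (lt_mem_nhds (half_lt_self h)))
    apply not_summable_one_div_tSeq ht₀
    have h2 : Summable fun k => 2 / ℓ * (p (k + K) / tSeq t₀ (k + K)) :=
      ((summable_nat_add_iff K).2 hs).mul_left _
    refine (summable_nat_add_iff K).1 (Summable.of_nonneg_of_le (fun k => ?_) (fun k => ?_) h2)
    · have : 0 < tSeq t₀ (k + K) := by rw [tSeq]; positivity
      positivity
    · have h3 : 0 < tSeq t₀ (k + K) := by rw [tSeq]; positivity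
      have h4 := hK (k + K) (Nat.le_add_left _ _)
      rw [div_mul_div_comm, div_le_div_iff₀ h3 (by positivity)]
      have := mul_le_mul_of_nonneg_right h4.le h3.le
      linarith

end RealSequences

/-! ### Linear recurrences hidden in the scheme. -/

section Recurrences

/-- The values `w^k = F x^k + ξ^k ∈ Φ x^k`. -/
def wVec {V : Type*} [Add V] (F : V → V) (x ξ : ℕ → V) (k : ℕ) : V := F (x k) + ξ k

/-- The errors `e^k = w^k - z^k`. -/
def errVec {V : Type*} [Sub V] (F : V → V) (x u : ℕ → V) (k : ℕ) : V := F (x k) - u k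

theorem zVec_eq {V : Type*} [NormedAddCommGroup V] (F : V → V) (x u ξ : ℕ → V) (k : ℕ) : zVec u ξ k = wVec F x ξ k - errVec F x u k := by
  simp only [zVec, wVec, errVec]; abel

variable {E : Type*} [NormedAddCommGroup E] [InnerProductSpace ℝ E]

/-- The extrapolation vector `t_k (y^k - x^k) + ((η - β) t_k - η (r - 1)) z^k`. -/
noncomputable def extraVec (r η β t₀ : ℝ) (x y u ξ : ℕ → E) (k : ℕ) : E :=
  tSeq t₀ k • (y k - x k) + ((η - β) * tSeq t₀ k - η * (r - 1)) • zVec u ξ k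

variable {F : E → E} {T : E → Set E} {r μ η β t₀ κ κ' : ℝ} {x y u ξ : ℕ → E}

theorem tSeq_pos (ht₀ : 0 < t₀) (k : ℕ) : 0 < tSeq t₀ k := by
  rw [tSeq]; positivity

theorem le_tSeq (k : ℕ) : t₀ ≤ tSeq t₀ k := by
  rw [tSeq]; linarith [(k.cast_nonneg : (0 : ℝ) ≤ k)]

theorem tSeq_succ (k : ℕ) : tSeq t₀ (k + 1) = tSeq t₀ k + 1 := by
  simp only [tSeq]; push_cast; ring

theorem dVec_eq (ht₀ : 0 < t₀) (k : ℕ) : dVec F r t₀ y u ξ k =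
    wHatSucc F y ξ k - zVec u ξ k + ((r - 1) / tSeq t₀ k) • zVec u ξ k := by
  have h := (tSeq_pos ht₀ k).ne'
  have : gam r t₀ k = 1 - (r - 1) / tSeq t₀ k := by
    rw [gam]; field_simp; ring
  rw [dVec, this]
  module

theorem IsGenerated.y_sub_x (hgen : IsGenerated F T r μ η β t₀ κ κ' x y u ξ) (k : ℕ) :
    y k - x k = (x (k + 1) - x k) + η • dVec F r t₀ y u ξ k := by
  rw [hgen.x_succ k]; abel

theorem IsGenerated.extraVec_eq (hgen : IsGenerated F T r μ η β t₀ κ κ' x y u ξ) (ht₀ : 0 < t₀)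
    (k : ℕ) : extraVec r η β t₀ x y u ξ k =
      tSeq t₀ k • (x (k + 1) - x k) + (η * tSeq t₀ k) • (wHatSucc F y ξ k - zVec u ξ k)
        + ((η - β) * tSeq t₀ k) • zVec u ξ k := by
  rw [extraVec, hgen.y_sub_x k, dVec_eq ht₀]
  have h := (tSeq_pos ht₀ k).ne'
  obtain ⟨c, hc⟩ : ∃ c, c = (r - 1) / tSeq t₀ k := ⟨_, rfl⟩
  have hr : r = c * tSeq t₀ k + 1 := by rw [hc]; field_simp; ring
  rw [← hc, hr]
  module

/-- Multiplying the update of y by t_{k+1} clears the denominators; δ is the value for which the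
coefficient of z^{k+1} collapses to -(r-2)ω, independent of k. -/
theorem IsGenerated.extraVec_succ (hgen : IsGenerated F T r μ η β t₀ κ κ' x y u ξ) (ht₀ : 0 < t₀)
    (hμ : 0 < μ) (k : ℕ) : extraVec r η β t₀ x y u ξ (k + 1) =
      extraVec r η β t₀ x y u ξ k - (r + μ) • (x (k + 1) - x k)
        - ((r - 2) * omega μ η β) • zVec u ξ (k + 1) := by
  have h1 := (tSeq_pos ht₀ (k + 1)).ne'
  have e1 : tSeq t₀ (k + 1) • (y (k + 1) - x (k + 1)) =
      (tSeq t₀ k - r - μ) • (x (k + 1) - x k)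
      - (((η - β) * tSeq t₀ k - delta r μ η β) • zVec u ξ (k + 1)
        - (η * tSeq t₀ k) • wHatSucc F y ξ k + (β * tSeq t₀ k) • zVec u ξ k) := by
    rw [hgen.y_succ k, pVec]
    simp only [smul_sub, smul_add, smul_smul]
    have a1 : tSeq t₀ (k + 1) * theta r μ t₀ k = tSeq t₀ k - r - μ := by
      rw [theta]; field_simp
    have a2 : tSeq t₀ (k + 1) * etaSeq r μ η β t₀ k = (η - β) * tSeq t₀ k - delta r μ η β := by
      rw [etaSeq]; field_simp
    have a3 : tSeq t₀ (k + 1) * lam η t₀ k = η * tSeq t₀ k := by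
      rw [lam]; field_simp
    have a4 : tSeq t₀ (k + 1) * nu β t₀ k = β * tSeq t₀ k := by
      rw [nu]; field_simp
    rw [a1, a2, a3, a4]
    abel
  obtain ⟨a, ha⟩ : ∃ a, a = (η - β) / (μ + 1) := ⟨_, rfl⟩
  have hμ1 : μ + 1 ≠ 0 := by positivity
  have hη : η = (μ + 1) * a + β := by rw [ha]; field_simp; ring
  have hω : omega μ η β = μ * a := by rw [omega, ha]; ring
  have hδ : delta r μ η β = (r - 1) * β + (r - 2) * a := by rw [delta, ha]; ring
  rw [hgen.extraVec_eq ht₀ k, extraVec, e1, hω, hδ, tSeq_succ, hη]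
  module

end Recurrences

/-! ### Boundedness and summability along the scheme. -/

section Scheme

variable {E : Type*} [NormedAddCommGroup E] [InnerProductSpace ℝ E]

/-- Co-hypomonotonicity lets ⟪w, X⟫ be negative by at most ρ‖w‖², which the t²‖w‖² term of the
energy absorbs for large t. -/
theorem mul_norm_sq_le_energy {r μ a K t ρ : ℝ} (hr : 0 < r) (hμ : 0 < μ) (ha : 0 < a) (hK : 0 ≤ K)
    (ht : 0 < t) (hta : 2 * r * ρ ≤ a * t) {V X w e : E}
    (hw : -inner ℝ w X ≤ ρ * ‖w‖ ^ 2) :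
    r * μ / 2 * ‖X‖ ^ 2 ≤ energy r μ a K t V X w e := by
  have h1 := mul_le_mul_of_nonneg_left hw (by positivity : 0 ≤ μ * a * r * t)
  have h2 := mul_le_mul_of_nonneg_left hta (by positivity : 0 ≤ μ * a / 2 * t * ‖w‖ ^ 2)
  have h3 : 0 ≤ ‖V‖ ^ 2 / 2 := by positivity
  have h4 : 0 ≤ K * t ^ 2 * ‖e‖ ^ 2 := by positivity
  rw [energy]
  linarith

variable {F : E → E} {T : E → Set E} {r μ η β t₀ κ κ' ρ : ℝ} {x y u ξ : ℕ → E} {xs : E}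

theorem IsGenerated.wVec_mem (hgen : IsGenerated F T r μ η β t₀ κ κ' x y u ξ) (k : ℕ) :
    (x k, wVec F x ξ k) ∈ graph (addOp F T) :=
  ⟨ξ k, hgen.mem k, rfl⟩

theorem CoHypomonotone.neg_inner_le {Φ : E → Set E} (hΦ : CoHypomonotone ρ Φ) {x u y v : E}
    (hx : (x, u) ∈ graph Φ) (hy : (y, v) ∈ graph Φ) :
    -inner ℝ (u - v) (x - y) ≤ ρ * ‖u - v‖ ^ 2 := by
  linarith [hΦ x u y v hx hy]

theorem CoHypomonotone.neg_inner_zer_le {Φ : E → Set E} (hΦ : CoHypomonotone ρ Φ) {x u y : E}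
    (hx : (x, u) ∈ graph Φ) (hy : y ∈ zer Φ) : -inner ℝ u (x - y) ≤ ρ * ‖u‖ ^ 2 := by
  simpa using hΦ.neg_inner_le hx (show (y, (0 : E)) ∈ graph Φ from hy)

/-- The momentum vector of the scheme, in terms of the iterates. -/
noncomputable def momentumSeq (r μ η β t₀ : ℝ) (F : E → E) (x y u ξ : ℕ → E) (xs : E) (k : ℕ) : E :=
  extraVec r η β t₀ x y u ξ k + r • (x k - xs) - (omega μ η β * tSeq t₀ k) • wVec F x ξ k

/-- The bounds produced by the Lyapunov function. -/
theorem IsGenerated.bounded_summable (hgen : IsGenerated F T r μ η β t₀ κ κ' x y u ξ)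
    (hr : 2 < r) (hμ : 0 < μ) (ht₀ : 0 < t₀) (hρ : 0 ≤ ρ) (hβ : 8 * ρ ≤ β) (hβη : β < η)
    (hΦ : CoHypomonotone ρ (addOp F T)) {M : ℝ} (hM : 0 ≤ M) (hκ : 0 ≤ κ) (hκ' : 0 ≤ κ')
    (hsmall : 4 * M + 18 * (κ * M + κ') < 1)
    (hF : ∀ k, ‖F (x (k + 1)) - F (y k)‖ ^ 2 ≤ M * ‖dVec F r t₀ y u ξ k‖ ^ 2)
    (hxs : xs ∈ zer (addOp F T)) :
    (∃ A, ∀ k, ‖x k - xs‖ ^ 2 ≤ A) ∧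
      Summable (fun k => tSeq t₀ k * (‖x (k + 1) - x k‖ ^ 2 + ‖wVec F x ξ k‖ ^ 2)
        + tSeq t₀ k ^ 2 * (‖dVec F r t₀ y u ξ k‖ ^ 2 + ‖errVec F x u k‖ ^ 2)) := by
  obtain ⟨a, ha⟩ : ∃ a, a = (η - β) / (μ + 1) := ⟨_, rfl⟩
  have hμ1 : μ + 1 ≠ 0 := by positivity
  have ha0 : 0 < a := by
    rw [ha]; exact div_pos (by linarith) (by linarith)
  have hη : η = (μ + 1) * a + β := by rw [ha]; field_simp; ring
  have hω : omega μ η β = μ * a := by rw [omega, ha]; ring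
  have hr0 : 0 < r := by linarith
  have hβ0 : 0 ≤ β := by linarith
  obtain ⟨c, C, T₀, hc, hC, hT₀, H⟩ := exists_energy_step_le (E := E) hr hμ ha0 hρ hβ hM hκ hκ'
    hsmall
  rw [← hη] at H
  have hK0 : 0 ≤ 2 * (μ * a) * η := by
    have : 0 ≤ η := by linarith
    positivity
  set K := 2 * (μ * a) * η with hK
  set En : ℕ → ℝ := fun k => energy r μ a K (tSeq t₀ k) (momentumSeq r μ η β t₀ F x y u ξ xs k)
    (x k - xs) (wVec F x ξ k) (errVec F x u k) with hEn
  set b : ℕ → ℝ := fun k => tSeq t₀ k * (‖x (k + 1) - x k‖ ^ 2 + ‖wVec F x ξ k‖ ^ 2)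
        + tSeq t₀ k ^ 2 * (‖dVec F r t₀ y u ξ k‖ ^ 2 + ‖errVec F x u k‖ ^ 2) with hb
  set C' := C / (r * μ / 2) with hC'
  have hC'0 : 0 ≤ C' := by positivity
  -- Shifting by n passes the thresholds of the energy step, of the lower bound on the energy and of
  -- the Gronwall lemma at once; a finite head affects neither boundedness nor summability.
  obtain ⟨n, hn⟩ := exists_nat_ge (T₀ + 2 * r * ρ / a + (1 + 3 * C'))
  have hρa : 0 ≤ 2 * r * ρ / a := by positivity
  have hn' : T₀ + 2 * r * ρ / a + (1 + 3 * C') ≤ n + t₀ := by linarith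
  have hshift : ∀ k, tSeq t₀ (k + n) = tSeq (n + t₀) k := fun k => by
    simp only [tSeq]; push_cast; ring
  have hlow : ∀ k, r * μ / 2 * ‖x (k + n) - xs‖ ^ 2 ≤ En (k + n) := fun k => by
    refine mul_norm_sq_le_energy hr0 hμ ha0 hK0 (tSeq_pos ht₀ _) ?_
      (hΦ.neg_inner_zer_le (hgen.wVec_mem _) hxs)
    have h1 : (n : ℝ) + t₀ ≤ tSeq t₀ (k + n) := by rw [hshift]; exact le_tSeq k
    have h2 : 2 * r * ρ / a ≤ tSeq t₀ (k + n) := by linarith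
    rw [div_le_iff₀ ha0] at h2
    linarith
  have hstep : ∀ k, En (k + n + 1) ≤
      (1 + C' / tSeq (n + t₀) k ^ 2) * En (k + n) - c * b (k + n) := fun k => by
    have h1 : (n : ℝ) + t₀ ≤ tSeq t₀ (k + n) := by rw [hshift]; exact le_tSeq k
    have hlowk := hlow k
    rw [← hshift]
    generalize k + n = j at *
    have htj := tSeq_pos ht₀ j
    have hf : wVec F x ξ (j + 1) - wHatSucc F y ξ j = F (x (j + 1)) - F (y j) := by
      simp only [wVec, wHatSucc]; abel
    have hd : dVec F r t₀ y u ξ j = (wVec F x ξ (j + 1) - wVec F x ξ j)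
        - (F (x (j + 1)) - F (y j)) + errVec F x u j
        + ((r - 1) / tSeq t₀ j) • (wVec F x ξ j - errVec F x u j) := by
      rw [dVec_eq ht₀, ← hf, ← zVec_eq, zVec_eq F x]
      module
    have key := H (tSeq t₀ j) (x j - xs) (x (j + 1) - x j) (wVec F x ξ j)
      (wVec F x ξ (j + 1) - wVec F x ξ j) (F (x (j + 1)) - F (y j)) (errVec F x u j)
      (errVec F x u (j + 1)) (dVec F r t₀ y u ξ j) (by linarith) hd (hF j) (hgen.u_cond j)
      (hΦ.neg_inner_le (hgen.wVec_mem _) (hgen.wVec_mem _))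
      (by
        rw [add_sub_cancel, add_comm (x j - xs), sub_add_sub_cancel]
        exact hΦ.neg_inner_zer_le (hgen.wVec_mem _) hxs)
    have e1 : momentum r μ a β (tSeq t₀ j) (x j - xs) (x (j + 1) - x j) (wVec F x ξ j)
        (wVec F x ξ (j + 1) - wVec F x ξ j) (F (x (j + 1)) - F (y j)) (errVec F x u j) =
        momentumSeq r μ η β t₀ F x y u ξ xs j := by
      rw [momentumSeq, hgen.extraVec_eq ht₀, ← hf, momentum, hω, zVec_eq F x, hη]
      module
    have e2 : momentumSeq r μ η β t₀ F x y u ξ xs j + momentumStep r μ a (tSeq t₀ j)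
        (x (j + 1) - x j) (wVec F x ξ j) (wVec F x ξ (j + 1) - wVec F x ξ j)
        (errVec F x u (j + 1)) = momentumSeq r μ η β t₀ F x y u ξ xs (j + 1) := by
      rw [momentumSeq, momentumSeq, hgen.extraVec_succ ht₀ hμ, momentumStep, hω, zVec_eq F x,
        tSeq_succ]
      module
    rw [e1, e2, add_sub_cancel, add_comm (x j - xs), sub_add_sub_cancel, ← tSeq_succ] at key
    have hX : C / tSeq t₀ j ^ 2 * ‖x j - xs‖ ^ 2 ≤ C' / tSeq t₀ j ^ 2 * En j := by
      have h2 := mul_le_mul_of_nonneg_left hlowk (by positivity : 0 ≤ C' / tSeq t₀ j ^ 2)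
      have h3 : C' / tSeq t₀ j ^ 2 * (r * μ / 2 * ‖x j - xs‖ ^ 2) =
          C / tSeq t₀ j ^ 2 * ‖x j - xs‖ ^ 2 := by
        rw [hC']; field_simp
      linarith
    simp only [hEn, hb] at hX ⊢
    linarith
  have hb0 : ∀ k, 0 ≤ b k := fun k => by
    have := tSeq_pos ht₀ k
    positivity
  obtain ⟨⟨A, hA⟩, hs⟩ := bounded_summable_of_le_one_add_div_sq (a := fun k => En (k + n))
    (b := fun k => c * b (k + n)) (t₀ := n + t₀) hC'0 (by linarith)
    (fun k => le_trans (by positivity) (hlow k)) (fun k => mul_nonneg hc.le (hb0 _))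
    (fun k => by
      have := hstep k
      rwa [add_right_comm] at this)
  constructor
  · have hbd : BddAbove (Set.range fun k => ‖x k - xs‖ ^ 2) := by
      have hev : ∀ k, n ≤ k → ‖x k - xs‖ ^ 2 ≤ A / (r * μ / 2) := fun k hk => by
        rw [le_div_iff₀ (by positivity), mul_comm]
        obtain ⟨j, rfl⟩ := Nat.exists_eq_add_of_le' hk
        exact (hlow j).trans (hA j)
      exact (isBoundedUnder_of_eventually_le (eventually_atTop.2 ⟨n, hev⟩)).bddAbove_range
    obtain ⟨A', hA'⟩ := hbd
    exact ⟨A', fun k => hA' ⟨k, rfl⟩⟩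
  · exact (summable_nat_add_iff n).1 ((summable_mul_left_iff hc.ne').1 hs)

end Scheme

/-! ### Convergence of the iterates. -/

section Convergence

theorem tendsto_zero_of_summable_sq {V : Type*} [NormedAddCommGroup V] {v : ℕ → V} {s : ℕ → ℝ} (hs : Summable s)
    (h : ∀ k, ‖v k‖ ^ 2 ≤ s k) : Tendsto v atTop (𝓝 0) := by
  rw [tendsto_zero_iff_norm_tendsto_zero]
  have := (squeeze_zero (fun k => sq_nonneg ‖v k‖) h hs.tendsto_atTop_zero).sqrt
  simpa using this

theorem mem_zer_of_tendsto {V : Type*} [NormedAddCommGroup V] {F : V → V} {T : V → Set V}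
    (hF : Continuous F) (hT : IsClosed (graph T)) {x ξ : ℕ → V} {a : V}
    (hξ : ∀ k, ξ k ∈ T (x k)) (hx : Tendsto x atTop (𝓝 a))
    (hw : Tendsto (fun k => F (x k) + ξ k) atTop (𝓝 0)) : a ∈ zer (addOp F T) := by
  have h1 : Tendsto ξ atTop (𝓝 (-F a)) := by
    have := hw.sub ((hF.tendsto a).comp hx)
    simpa using this
  have h2 : (a, -F a) ∈ graph T := hT.mem_of_tendsto (hx.prodMk_nhds h1)
    (Eventually.of_forall fun k => hξ k)
  exact ⟨-F a, h2, (add_neg_cancel _).symm⟩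

variable {E : Type*} [NormedAddCommGroup E] [InnerProductSpace ℝ E]

theorem norm_one_sub_smul_add_sq_le {s : ℝ} (hs : 0 < s) (hs1 : s ≤ 1) (u q : E) :
    ‖(1 - s) • u + q‖ ^ 2 ≤ (1 - s) * ‖u‖ ^ 2 + 1 / s * ‖q‖ ^ 2 := by
  have h1 := inner_le_young (s := s / 2) (by positivity) u q
  have h2 : 1 / (4 * (s / 2)) = 1 / s / 2 := by field_simp; norm_num
  rw [h2] at h1
  have h3 := mul_le_mul_of_nonneg_left h1 (by linarith : 0 ≤ 2 * (1 - s))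
  rw [norm_add_sq_real, norm_smul_sq, inner_smul_left, RCLike.conj_to_real]
  have h4 : s * (1 / s) = 1 := by field_simp
  have h5 : s * (1 / s) * ‖q‖ ^ 2 = ‖q‖ ^ 2 := by rw [h4, one_mul]
  linarith

theorem norm_add_three_sq_le (u v w : E) :
    ‖u + v + w‖ ^ 2 ≤ 4 * (‖u‖ ^ 2 + ‖v‖ ^ 2 + ‖w‖ ^ 2) := by
  have h1 := norm_add_sq_le (u + v) w
  have h2 := norm_add_sq_le u v
  linarith [sq_nonneg ‖w‖]

variable {F : E → E} {T : E → Set E} {r μ η β t₀ κ κ' ρ : ℝ} {x y u ξ : ℕ → E} {xs : E}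

theorem IsGenerated.extraVec_succ_eq (hgen : IsGenerated F T r μ η β t₀ κ κ' x y u ξ)
    (ht₀ : 0 < t₀) (hμ : 0 < μ) (k : ℕ) : extraVec r η β t₀ x y u ξ (k + 1) =
      (1 - (r + μ) / tSeq t₀ k) • extraVec r η β t₀ x y u ξ k
        + (((r + μ) * η) • dVec F r t₀ y u ξ k
          + ((r + μ) * ((η - β) - η * (r - 1) / tSeq t₀ k)) • zVec u ξ k
          + (-((r - 2) * omega μ η β)) • zVec u ξ (k + 1)) := by
  have h := (tSeq_pos ht₀ k).ne'
  obtain ⟨c, hc⟩ : ∃ c, c = (r + μ) / tSeq t₀ k := ⟨_, rfl⟩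
  have hc' : r + μ = c * tSeq t₀ k := by rw [hc]; field_simp
  obtain ⟨d, hd⟩ : ∃ d, d = η * (r - 1) / tSeq t₀ k := ⟨_, rfl⟩
  have hd' : η * (r - 1) = d * tSeq t₀ k := by rw [hd]; field_simp
  rw [hgen.extraVec_succ ht₀ hμ, ← hc, ← hd, hc']
  have e : extraVec r η β t₀ x y u ξ k = tSeq t₀ k • (x (k + 1) - x k)
      + (η * tSeq t₀ k) • dVec F r t₀ y u ξ k
      + ((η - β) * tSeq t₀ k - d * tSeq t₀ k) • zVec u ξ k := by
    rw [extraVec, hgen.y_sub_x k, hd']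
    module
  rw [e]
  module

/-- By convexity, contraction by 1 - (r+μ)/t_k costs the square of the perturbation times t_k/(r+μ),
which is summable. So ‖U_k‖² converges with ∑ ‖U_k‖²/t_k finite, which forces the limit 0. -/
theorem IsGenerated.extraVec_tendsto_zero (hgen : IsGenerated F T r μ η β t₀ κ κ' x y u ξ)
    (hr : 2 < r) (hμ : 0 < μ) (ht₀ : 1 ≤ t₀)
    (hz : Summable fun k => tSeq t₀ k * ‖zVec u ξ k‖ ^ 2)
    (hd : Summable fun k => tSeq t₀ k * ‖dVec F r t₀ y u ξ k‖ ^ 2) :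
    Tendsto (extraVec r η β t₀ x y u ξ) atTop (𝓝 0) ∧
      Summable fun k => ‖extraVec r η β t₀ x y u ξ k‖ ^ 2 / tSeq t₀ k := by
  have ht₀' : 0 < t₀ := by linarith
  set U := extraVec r η β t₀ x y u ξ with hU
  set c₁ := ((r + μ) * η) ^ 2 with hc₁
  set c₂ := ((r + μ) * (|η - β| + |η * (r - 1)|)) ^ 2 with hc₂
  set c₃ := (-((r - 2) * omega μ η β)) ^ 2 with hc₃
  have hz1 : Summable fun k => tSeq t₀ (k + 1) * ‖zVec u ξ (k + 1)‖ ^ 2 :=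
    (summable_nat_add_iff 1).2 hz
  have hq := (((hd.mul_left c₁).add (hz.mul_left c₂)).add (hz1.mul_left c₃)).mul_left 4
  obtain ⟨n, hn⟩ := exists_nat_ge (r + μ)
  have hstep : ∀ k, ‖U (k + n + 1)‖ ^ 2 ≤ ‖U (k + n)‖ ^ 2 - ‖U (k + n)‖ ^ 2 / tSeq t₀ (k + n)
      + 4 * (c₁ * (tSeq t₀ (k + n) * ‖dVec F r t₀ y u ξ (k + n)‖ ^ 2)
        + c₂ * (tSeq t₀ (k + n) * ‖zVec u ξ (k + n)‖ ^ 2)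
        + c₃ * (tSeq t₀ (k + n + 1) * ‖zVec u ξ (k + n + 1)‖ ^ 2)) := fun k => by
    have hj : r + μ ≤ tSeq t₀ (k + n) := by
      rw [tSeq]; push_cast
      linarith [(k.cast_nonneg : (0 : ℝ) ≤ k)]
    generalize k + n = j at *
    have ht := tSeq_pos ht₀' j
    have ht1 : 1 ≤ tSeq t₀ j := ht₀.trans (le_tSeq j)
    have hs : 0 < (r + μ) / tSeq t₀ j := by positivity
    have h1 := norm_one_sub_smul_add_sq_le hs ((div_le_one ht).2 hj) (U j)
      (((r + μ) * η) • dVec F r t₀ y u ξ j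
          + ((r + μ) * ((η - β) - η * (r - 1) / tSeq t₀ j)) • zVec u ξ j
          + (-((r - 2) * omega μ η β)) • zVec u ξ (j + 1))
    rw [hU, ← hgen.extraVec_succ_eq ht₀' hμ j, ← hU] at h1
    have h2 := norm_add_three_sq_le (((r + μ) * η) • dVec F r t₀ y u ξ j)
      (((r + μ) * ((η - β) - η * (r - 1) / tSeq t₀ j)) • zVec u ξ j)
      ((-((r - 2) * omega μ η β)) • zVec u ξ (j + 1))
    rw [norm_smul_sq, norm_smul_sq, norm_smul_sq] at h2
    have h3 : ((r + μ) * ((η - β) - η * (r - 1) / tSeq t₀ j)) ^ 2 ≤ c₂ := by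
      rw [hc₂, mul_pow, mul_pow]
      refine mul_le_mul_of_nonneg_left (sq_le_sq' ?_ ?_) (sq_nonneg _) <;>
      · have a1 : |η * (r - 1) / tSeq t₀ j| ≤ |η * (r - 1)| := by
          rw [abs_div, abs_of_pos ht]
          exact div_le_self (abs_nonneg _) ht1
        linarith [neg_abs_le (η - β), le_abs_self (η - β), neg_abs_le (η * (r - 1) / tSeq t₀ j),
          le_abs_self (η * (r - 1) / tSeq t₀ j)]
    have h4 : 1 / ((r + μ) / tSeq t₀ j) ≤ tSeq t₀ j := by
      rw [one_div_div]
      exact div_le_self ht.le (by linarith)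
    have h5 : ‖U j‖ ^ 2 / tSeq t₀ j ≤ (r + μ) / tSeq t₀ j * ‖U j‖ ^ 2 := by
      rw [div_mul_eq_mul_div]
      gcongr
      exact le_mul_of_one_le_left (sq_nonneg _) (by linarith)
    have h6 := mul_le_mul_of_nonneg_right h3 (sq_nonneg ‖zVec u ξ j‖)
    have h7 : tSeq t₀ j * (c₃ * ‖zVec u ξ (j + 1)‖ ^ 2) ≤
        tSeq t₀ (j + 1) * (c₃ * ‖zVec u ξ (j + 1)‖ ^ 2) := by
      rw [tSeq_succ]
      gcongr
      linarith
    have h8 := mul_le_mul h4 (h2.trans (mul_le_mul_of_nonneg_left (add_le_add_left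
      (add_le_add_right h6 _) _) (by norm_num : (0 : ℝ) ≤ 4))) (sq_nonneg _) ht.le
    linarith
  obtain ⟨⟨ℓ, hℓ⟩, hs⟩ := quasi_fejer (a := fun k => ‖U (k + n)‖ ^ 2)
    (b := fun k => ‖U (k + n)‖ ^ 2 / tSeq t₀ (k + n))
    (fun k => by positivity) (fun k => by have := tSeq_pos ht₀' (k + n); positivity)
    ((summable_nat_add_iff n).2 hq) (fun k => by
      simp only [add_right_comm k 1 n]
      exact hstep k)
  have hs' : Summable fun k => ‖U k‖ ^ 2 / tSeq t₀ k :=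
    (summable_nat_add_iff (f := fun k => ‖U k‖ ^ 2 / tSeq t₀ k) n).1 hs
  have hℓ' : Tendsto (fun k => ‖U k‖ ^ 2) atTop (𝓝 ℓ) :=
    (tendsto_add_atTop_iff_nat (f := fun k => ‖U k‖ ^ 2) n).1 hℓ
  refine ⟨?_, hs'⟩
  have h0 := tendsto_zero_of_summable_div_tSeq ht₀' (fun k => sq_nonneg _) hℓ' hs'
  rw [tendsto_zero_iff_norm_tendsto_zero]
  simpa using h0.sqrt

theorem IsGenerated.norm_sub_tendsto (hgen : IsGenerated F T r μ η β t₀ κ κ' x y u ξ)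
    (hr : 2 < r) (hμ : 0 < μ) (ht₀ : 1 ≤ t₀) (hρ : 0 ≤ ρ) (hβη : β < η)
    (hΦ : CoHypomonotone ρ (addOp F T))
    (hw : Summable fun k => tSeq t₀ k * ‖wVec F x ξ k‖ ^ 2)
    (hz : Summable fun k => tSeq t₀ k * ‖zVec u ξ k‖ ^ 2)
    (hd : Summable fun k => tSeq t₀ k * ‖dVec F r t₀ y u ξ k‖ ^ 2)
    (he : Summable fun k => tSeq t₀ k ^ 2 * ‖errVec F x u k‖ ^ 2)
    (hbdd : ∃ A, ∀ k, ‖x k - xs‖ ^ 2 ≤ A) (hxs : xs ∈ zer (addOp F T)) :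
    ∃ ℓ, Tendsto (fun k => ‖x k - xs‖) atTop (𝓝 ℓ) := by
  have ht₀' : 0 < t₀ := by linarith
  obtain ⟨hU0, hUs⟩ := hgen.extraVec_tendsto_zero hr hμ ht₀ hz hd
  obtain ⟨A, hA⟩ := hbdd
  set U := extraVec r η β t₀ x y u ξ with hU
  set c := r + μ with hc
  have hc0 : 0 < c := by linarith
  set W : ℕ → E := fun k => U k + c • (x k - xs) with hW
  set s := (r - 2) * omega μ η β with hs
  have hs0 : 0 ≤ s := by
    have h1 : 0 < η - β := by linarith
    have h2 : 0 < r - 2 := by linarith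
    rw [hs, omega]
    positivity
  have hWs : ∀ k, W (k + 1) = W k - s • zVec u ξ (k + 1) := fun k => by
    simp only [hW, hU]
    rw [hgen.extraVec_succ ht₀' hμ]
    module
  -- Q bounds -⟪z, W⟫ piecewise: Young on ⟪z, U⟫, co-hypomonotonicity on ⟪w, x - x⋆⟫, and Young with
  -- weight t² on ⟪e, x - x⋆⟫, where boundedness of x enters.
  set Q : ℕ → ℝ := fun k => tSeq t₀ k * ‖zVec u ξ k‖ ^ 2 + ‖U k‖ ^ 2 / tSeq t₀ k
    + c * ρ * (tSeq t₀ k * ‖wVec F x ξ k‖ ^ 2)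
    + c * (tSeq t₀ k ^ 2 * ‖errVec F x u k‖ ^ 2 + A * (1 / tSeq t₀ k ^ 2)) with hQ
  have hQs : Summable Q := ((hz.add hUs).add (hw.mul_left _)).add
    ((he.add ((summable_one_div_tSeq_sq ht₀').mul_left A)).mul_left c)
  have hzW : ∀ k, -inner ℝ (zVec u ξ k) (W k) ≤ Q k := fun k => by
    have ht := tSeq_pos ht₀' k
    have ht1 : 1 ≤ tSeq t₀ k := ht₀.trans (le_tSeq k)
    have e1 : inner ℝ (zVec u ξ k) (W k) = inner ℝ (zVec u ξ k) (U k)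
        + c * (inner ℝ (wVec F x ξ k) (x k - xs) - inner ℝ (errVec F x u k) (x k - xs)) := by
      simp only [hW]
      rw [inner_add_right, inner_smul_right, ← inner_sub_left, ← zVec_eq]
    have h1 := inner_le_young ht (zVec u ξ k) (-U k)
    rw [inner_neg_right, norm_neg] at h1
    have h1' : 1 / (4 * tSeq t₀ k) * ‖U k‖ ^ 2 ≤ ‖U k‖ ^ 2 / tSeq t₀ k := by
      rw [one_div_mul_eq_div]
      gcongr
      linarith
    have h2 := hΦ.neg_inner_zer_le (hgen.wVec_mem k) hxs
    have h2' : ρ * ‖wVec F x ξ k‖ ^ 2 ≤ ρ * (tSeq t₀ k * ‖wVec F x ξ k‖ ^ 2) := by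
      gcongr
      exact le_mul_of_one_le_left (sq_nonneg _) ht1
    have h3 := inner_le_young (pow_pos ht 2) (errVec F x u k) (x k - xs)
    have h3' : 1 / (4 * tSeq t₀ k ^ 2) * ‖x k - xs‖ ^ 2 ≤ A * (1 / tSeq t₀ k ^ 2) := by
      rw [mul_comm A]
      refine mul_le_mul ?_ (hA k) (sq_nonneg _) (by positivity)
      gcongr
      linarith [sq_nonneg (tSeq t₀ k)]
    have h4 := mul_le_mul_of_nonneg_left (h2.trans h2') hc0.le
    have h5 := mul_le_mul_of_nonneg_left (h3.trans (add_le_add_right h3' _)) hc0.le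
    simp only [hQ]
    rw [e1]
    linarith
  obtain ⟨⟨ℓ, hℓ⟩, -⟩ := quasi_fejer (a := fun k => ‖W k‖ ^ 2) (b := fun _ => 0)
    (q := fun k => 2 * s * Q (k + 1)) (fun k => sq_nonneg _) (fun _ => le_rfl)
    (((summable_nat_add_iff 1).2 hQs).mul_left _) (fun k => by
      -- Read backwards, the step is implicit: z^{k+1} is paired with W_{k+1}, and the leftover
      -- square has the favourable sign.
      have e1 : W k = W (k + 1) + s • zVec u ξ (k + 1) := by rw [hWs]; abel
      have h1 := mul_le_mul_of_nonneg_left (hzW (k + 1)) (by linarith : 0 ≤ 2 * s)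
      have h2 : ‖W k‖ ^ 2 = ‖W (k + 1)‖ ^ 2 + 2 * (s * inner ℝ (zVec u ξ (k + 1)) (W (k + 1)))
          + ‖s • zVec u ξ (k + 1)‖ ^ 2 := by
        rw [e1, norm_add_sq_real, inner_smul_right, real_inner_comm]
      have h3 := sq_nonneg ‖s • zVec u ξ (k + 1)‖
      linarith)
  have hWn : Tendsto (fun k => ‖W k‖) atTop (𝓝 (Real.sqrt ℓ)) := by
    simpa using hℓ.sqrt
  have hdiff : Tendsto (fun k => ‖W k - U k‖ - ‖W k‖) atTop (𝓝 0) := by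
    refine squeeze_zero_norm (fun k => ?_) (tendsto_zero_iff_norm_tendsto_zero.1 hU0)
    have := abs_norm_sub_norm_le (W k - U k) (W k)
    rwa [sub_sub_cancel_left, norm_neg] at this
  refine ⟨c⁻¹ * Real.sqrt ℓ, ?_⟩
  have := (hdiff.add hWn).const_mul c⁻¹
  rw [zero_add] at this
  refine this.congr fun k => ?_
  simp only [hW]
  rw [sub_add_cancel, add_sub_cancel_left, norm_smul, Real.norm_of_nonneg hc0.le]
  field_simp

theorem IsGenerated.tendsto [ProperSpace E] (hgen : IsGenerated F T r μ η β t₀ κ κ' x y u ξ)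
    (hr : 2 < r) (hμ : 0 < μ) (ht₀ : 1 ≤ t₀) (hρ : 0 ≤ ρ) (hβ : 8 * ρ ≤ β) (hβη : β < η)
    (hΦ : CoHypomonotone ρ (addOp F T)) (hzer : (zer (addOp F T)).Nonempty)
    {L : NNReal} (hF : LipschitzWith L F) (hT : IsClosed (graph T)) (hκ : 0 ≤ κ) (hκ' : 0 ≤ κ')
    (hsmall : 4 * (L * η) ^ 2 + 18 * (κ * (L * η) ^ 2 + κ') < 1) :
    ∃ a ∈ zer (addOp F T), Tendsto x atTop (𝓝 a) ∧ Tendsto y atTop (𝓝 a) := by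
  have ht₀' : 0 < t₀ := by linarith
  have hη0 : 0 ≤ η := by linarith
  have hFd : ∀ k, ‖F (x (k + 1)) - F (y k)‖ ^ 2 ≤
      ((L : ℝ) * η) ^ 2 * ‖dVec F r t₀ y u ξ k‖ ^ 2 := fun k => by
    have h1 := hF.norm_sub_le (x (k + 1)) (y k)
    rw [hgen.x_succ k, sub_sub_cancel_left, norm_neg, norm_smul, Real.norm_of_nonneg hη0,
      ← mul_assoc, ← hgen.x_succ k] at h1
    rw [← mul_pow]
    gcongr
  have hbs := fun xs (hxs : xs ∈ zer (addOp F T)) => hgen.bounded_summable hr hμ ht₀' hρ hβ hβη hΦ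
    (sq_nonneg _) hκ hκ' hsmall hFd hxs
  obtain ⟨x₀, hx₀⟩ := hzer
  have hsum := (hbs x₀ hx₀).2
  have hpos := fun k => tSeq_pos ht₀' k
  have hge : ∀ k, 1 ≤ tSeq t₀ k := fun k => ht₀.trans (le_tSeq k)
  have hsq : ∀ k, tSeq t₀ k ≤ tSeq t₀ k ^ 2 := fun k => le_self_pow₀ (hge k) two_ne_zero
  have hDk : ∀ k, 0 ≤ tSeq t₀ k * ‖x (k + 1) - x k‖ ^ 2 := fun k =>
    mul_nonneg (hpos k).le (sq_nonneg _)
  have hwk : ∀ k, 0 ≤ tSeq t₀ k * ‖wVec F x ξ k‖ ^ 2 := fun k =>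
    mul_nonneg (hpos k).le (sq_nonneg _)
  have hdk : ∀ k, 0 ≤ tSeq t₀ k * ‖dVec F r t₀ y u ξ k‖ ^ 2 := fun k =>
    mul_nonneg (hpos k).le (sq_nonneg _)
  have hek : ∀ k, 0 ≤ tSeq t₀ k * ‖errVec F x u k‖ ^ 2 := fun k =>
    mul_nonneg (hpos k).le (sq_nonneg _)
  have hdk' : ∀ k, tSeq t₀ k * ‖dVec F r t₀ y u ξ k‖ ^ 2 ≤
      tSeq t₀ k ^ 2 * ‖dVec F r t₀ y u ξ k‖ ^ 2 := fun k =>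
    mul_le_mul_of_nonneg_right (hsq k) (sq_nonneg _)
  have hek' : ∀ k, tSeq t₀ k * ‖errVec F x u k‖ ^ 2 ≤
      tSeq t₀ k ^ 2 * ‖errVec F x u k‖ ^ 2 := fun k =>
    mul_le_mul_of_nonneg_right (hsq k) (sq_nonneg _)
  have hw : Summable fun k => tSeq t₀ k * ‖wVec F x ξ k‖ ^ 2 :=
    Summable.of_nonneg_of_le hwk
      (fun k => by linarith [hDk k, hdk k, hek k, hdk' k, hek' k]) hsum
  have hD : Summable fun k => tSeq t₀ k * ‖x (k + 1) - x k‖ ^ 2 :=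
    Summable.of_nonneg_of_le hDk
      (fun k => by linarith [hwk k, hdk k, hek k, hdk' k, hek' k]) hsum
  have hd : Summable fun k => tSeq t₀ k * ‖dVec F r t₀ y u ξ k‖ ^ 2 :=
    Summable.of_nonneg_of_le hdk
      (fun k => by linarith [hwk k, hDk k, hek k, hdk' k, hek' k]) hsum
  have he : Summable fun k => tSeq t₀ k ^ 2 * ‖errVec F x u k‖ ^ 2 :=
    Summable.of_nonneg_of_le (fun k => (hek k).trans (hek' k))
      (fun k => by linarith [hwk k, hDk k, hdk k, hdk' k, hek' k]) hsum
  have hz : Summable fun k => tSeq t₀ k * ‖zVec u ξ k‖ ^ 2 := by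
    refine Summable.of_nonneg_of_le (fun k => mul_nonneg (hpos k).le (sq_nonneg _))
      (fun k => ?_) ((hw.add he).mul_left 2)
    have h1 := norm_sub_sq_le (wVec F x ξ k) (errVec F x u k)
    rw [← zVec_eq] at h1
    have h2 := mul_le_mul_of_nonneg_left h1 (hpos k).le
    linarith [hek' k]
  have hw0 : Tendsto (wVec F x ξ) atTop (𝓝 0) :=
    tendsto_zero_of_summable_sq hw fun k => le_mul_of_one_le_left (sq_nonneg _) (hge k)
  have hD0 : Tendsto (fun k => x (k + 1) - x k) atTop (𝓝 0) :=
    tendsto_zero_of_summable_sq hD fun k => le_mul_of_one_le_left (sq_nonneg _) (hge k)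
  have hd0 : Tendsto (dVec F r t₀ y u ξ) atTop (𝓝 0) :=
    tendsto_zero_of_summable_sq hd fun k => le_mul_of_one_le_left (sq_nonneg _) (hge k)
  obtain ⟨A, hA⟩ := (hbs x₀ hx₀).1
  obtain ⟨a, -, φ, hφ, hφa⟩ := tendsto_subseq_of_bounded
    (Metric.isBounded_closedBall (x := x₀) (r := Real.sqrt A)) (x := x)
    (fun k => by rw [mem_closedBall_iff_norm]; exact Real.le_sqrt_of_sq_le (hA k))
  have ha : a ∈ zer (addOp F T) := mem_zer_of_tendsto hF.continuous hT
    (fun k => hgen.mem (φ k)) hφa (hw0.comp hφ.tendsto_atTop)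
  -- The summability facts do not involve the zero, so those obtained from x₀ serve again with the
  -- cluster point a as reference.
  obtain ⟨ℓ, hℓ⟩ := hgen.norm_sub_tendsto hr hμ ht₀ hρ hβη hΦ hw hz hd he (hbs a ha).1 ha
  have hℓ0 : ℓ = 0 := tendsto_nhds_unique (hℓ.comp hφ.tendsto_atTop)
    (tendsto_iff_norm_sub_tendsto_zero.1 hφa)
  have hx : Tendsto x atTop (𝓝 a) := by
    rw [tendsto_iff_norm_sub_tendsto_zero, ← hℓ0]
    exact hℓ
  refine ⟨a, ha, hx, ?_⟩
  have h1 := hx.add (hD0.add (hd0.const_smul η))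
  rw [smul_zero, add_zero, add_zero] at h1
  refine h1.congr fun k => ?_
  rw [← hgen.y_sub_x k]
  abel

end Convergence

/-! ### Consequences of the parameter choices. -/

theorem le_tZero (r μ η β ρ ε' : ℝ) : r ≤ tZero r μ η β ρ ε' := by
  simp only [tZero, le_max_iff, le_refl, true_or, or_true]

/-- Squaring η < Ψ/L gives (Lη)² S < Y² ≤ Y, as 0 < Y ≤ 1. Since 3r > 6, both occurrences of 12 + 3r
are at least 18. -/
theorem small_of_lt_etaBar {L r κ κ' ε' η : ℝ} (hL : 0 < L) (hr : 2 < r) (hκ : 0 ≤ κ)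
    (hκ' : 0 ≤ κ') (hε' : 0 ≤ ε') (hη₀ : 0 ≤ η) (hη : η < etaBar L r κ κ' ε') :
    4 * (L * η) ^ 2 + 18 * (κ * (L * η) ^ 2 + κ') < 1 := by
  have hr0 : 0 < r := by linarith
  set S := 4 + 12 * κ + 3 * κ * r + κ * ε' with hS
  have hS0 : 0 < S := by positivity
  set Y := 1 - 1 / (3 * r) - κ' * (12 + 3 * r + ε') with hY
  have hsq := Real.sqrt_pos.2 hS0
  rw [etaBar, lt_div_iff₀ hL, Psi, ← hS, ← hY, one_div_mul_eq_div, lt_div_iff₀ hsq] at hη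
  have h0 : 0 ≤ η * L * Real.sqrt S := by positivity
  have hY0 : 0 < Y := h0.trans_lt hη
  have h1 : (L * η) ^ 2 * S < Y ^ 2 := by
    have h2 := pow_lt_pow_left₀ hη h0 two_ne_zero
    rw [mul_pow, Real.sq_sqrt hS0.le] at h2
    linarith
  have h2 : 0 < 1 / (3 * r) := by positivity
  have h3 : 0 ≤ κ' * (12 + 3 * r + ε') := by positivity
  have hY1 : Y ≤ 1 := by rw [hY]; linarith
  have h4 : Y ^ 2 ≤ Y := by nlinarith
  have h5 : κ' * 18 ≤ κ' * (12 + 3 * r + ε') := by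
    gcongr
    linarith
  have h6 : (L * η) ^ 2 * (4 + 18 * κ) ≤ (L * η) ^ 2 * S := by
    have h7 := mul_le_mul_of_nonneg_left hr.le hκ
    have h8 := mul_nonneg hκ hε'
    refine mul_le_mul_of_nonneg_left ?_ (sq_nonneg _)
    rw [hS]
    linarith
  rw [hY] at h4 h1
  linarith

end GAEGPlus

theorem theorem7p6 {p : ℕ}
    (F : EuclideanSpace ℝ (Fin p) → EuclideanSpace ℝ (Fin p))
    (T : EuclideanSpace ℝ (Fin p) → Set (EuclideanSpace ℝ (Fin p)))
    (L : NNReal) (ρ r μ κ κ' ε ε' η : ℝ)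
    (hzer : (GAEGPlus.zer (GAEGPlus.addOp F T)).Nonempty)
    (hρ : 0 ≤ ρ)
    (hΦ : GAEGPlus.CoHypomonotone ρ (GAEGPlus.addOp F T))
    (hL : 0 < L) (hF : LipschitzWith L F)
    (hT : IsClosed (GAEGPlus.graph T))
    (hr : 2 < r) (hμ : 1 < μ)
    (hε : 0 ≤ ε) (hε' : 0 ≤ ε')
    (hκ : 0 ≤ κ) (hκ'₀ : 0 ≤ κ')
    (hκ' : κ' < (3 * r - 1) / (3 * r * (12 + 3 * r + ε')))
    (hLρ : (L : ℝ) * ρ < (r - 2) * GAEGPlus.Psi r κ κ' ε' / (8 * (r + μ - 1)))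
    (hβη : GAEGPlus.beta ρ ε < η)
    (hη₁ : (r + μ - 1) * GAEGPlus.beta ρ ε / (r - 2) ≤ η)
    (hη₂ : η < GAEGPlus.etaBar L r κ κ' ε')
    (x y u ξ : ℕ → EuclideanSpace ℝ (Fin p))
    (hgen : GAEGPlus.IsGenerated F T r μ η (GAEGPlus.beta ρ ε)
      (GAEGPlus.tZero r μ η (GAEGPlus.beta ρ ε) ρ ε') κ κ' x y u ξ) :
    ∃ xstar ∈ GAEGPlus.zer (GAEGPlus.addOp F T),
      Filter.Tendsto x Filter.atTop (nhds xstar) ∧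
        Filter.Tendsto y Filter.atTop (nhds xstar) := by
  have hβ : 8 * ρ ≤ GAEGPlus.beta ρ ε := by rw [GAEGPlus.beta]; linarith
  exact hgen.tendsto hr (by linarith)
    (by linarith [GAEGPlus.le_tZero r μ η (GAEGPlus.beta ρ ε) ρ ε']) hρ hβ hβη hΦ hzer hF hT hκ hκ'₀
    (GAEGPlus.small_of_lt_etaBar (NNReal.coe_pos.2 hL) hr hκ hκ'₀ hε' (by linarith) hη₂)
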